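/- Let $K$ be a finite field, let $S=K[t_1,\ldots,t_s]=\bigoplus_{d\ge 0}S_d$ have the standard grading, and let $\prec$ be the graded reverse lexicographic (GRevLex) order on $S$: $t^a\succ t^b$ if $\deg t^a>\deg t^b$, or $\deg t^a=\deg t^b$ and the last non-zero entry of $a-b$ is negative. Let $\mathbb{X}=\{[P_1],\ldots,[P_m]\}$ be a set of $m\geq 2$ distinct points of $\mathbb{P}^{s-1}$ over $K$ with fixed representatives $P_i\in K^s\setminus\{0\}$, let $I=I(\mathbb{X})$ be the ideal of $S$ generated by the homogeneous polynomials that vanish at all points of $\mathbb{X}$, and let $\mathfrak{p}_i$ be the vanishing ideal of $[P_i]$. Let $\Delta_\prec(I)$ be the set of standard monomials of $S/I$ (the monomials not in the initial ideal ${\rm in}_\prec(I)$), $\Delta_\prec(I)_d$ the set of those of degree $d$, and $K\Delta_\prec(I)$ the $K$-span of $\Delta_\prec(I)$. Let $b_{i,j}$ be the graded Betti numbers of the minimal graded free resolution of $S/I$, let $g$ be its length, and let $r_0={\rm reg}(S/I)=\max\{j-i\mid b_{i,j}\neq 0\}$. The ideal $I$ is Gorenstein if there is a unique $j$ with $b_{g,j}\neq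 0$ and, for this $j$, $b_{g,j}=1$. For each $i$ let $f_i$ be the $i$-th standard indicator function of $\mathbb{X}$: the homogeneous polynomial in $K\Delta_\prec(I)$ (unique up to a factor in $K^*=K\setminus\{0\}$) of degree ${\rm v}_{\mathfrak{p}_i}(I)=\min\{d\mid \exists f\in S_d,\ (I\colon f)=\mathfrak{p}_i\}$ with $f_i(P_i)\neq 0$ and $f_i(P_j)=0$ for $j\neq i$. Let ${\rm lc}(f_i)$ be its leading coefficient. A standard monomial is essential if it appears in every $f_i$. Let $C_\mathbb{X}(d)=\{(f(P_1),\ldots,f(P_m))\mid f\in S_d\}\subset K^m$. Suppose that $t_s$ is regular (a non-zero-divisor) on $S/I$ and that $I$ is Gorenstein. Then: (a) There is $t^a\in\Delta_\prec(I)_{r_0}$ such that $t_s$ does not divide $t^a$ and every $f_i$ has the form $f_i=\lambda_i t^a+t_sG_i$ for some $\lambda_i\in K^*$ and $G_i\in S_{r_0-1}$. In particular, $t^a$ is essential and $\lambda_i={\rm lc}(f_i)$. (b) If $t_s(P_i)=1$ for all $i$, then the $1\times m$ matrix $H=({\rm lc}(f_1)f_1(P_1)^{-1},\ldots,{\rm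 lc}(f_m)f_m(P_m)^{-1})$ is a parity check matrix of $C_\mathbb{X}(r_0-1)$, that is, the row of $H$ is linearly independent (non-zero) and $C_\mathbb{X}(r_0-1)=\{x\in K^m\mid Hx=0\}$. -/

import Mathlib

open MvPolynomial

/-! ### The graded reverse lexicographic order

The variables `t_1, …, t_s` are indexed by `Fin (n + 1)`, so that `s = n + 1` and the last variable
`t_s` is `X (Fin.last n)`. -/

/-- Exponent vectors of monomials in `n + 1` variables, to be ordered by GRevLex. -/
def GRevLexExp (n : ℕ) : Type := Fin (n + 1) →₀ ℕ

namespace GRevLexExp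

variable {n : ℕ}

noncomputable instance : AddCommMonoid (GRevLexExp n) :=
  inferInstanceAs (AddCommMonoid (Fin (n + 1) →₀ ℕ))

/-- The tuple of partial sums `(a_1 + ⋯ + a_s, a_1 + ⋯ + a_{s-1}, …, a_1)`. Comparing these tuples
lexicographically is GRevLex, see `MonomialOrder.grevLex_lt_iff`. -/
noncomputable def key (a : Fin (n + 1) →₀ ℕ) : Lex (Fin (n + 1) → ℕ) :=
  toLex fun k => ∑ i ∈ Finset.Iic (Fin.rev k), a i

theorem key_apply (a : Fin (n + 1) →₀ ℕ) (k : Fin (n + 1)) :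
    key a k = ∑ i ∈ Finset.Iic (Fin.rev k), a i := rfl

theorem key_add (a b : Fin (n + 1) →₀ ℕ) : key (a + b) = key a + key b := by
  funext k
  exact Finset.sum_add_distrib (s := Finset.Iic (Fin.rev k)) (f := a) (g := b)

theorem key_zero_eq_degree (a : Fin (n + 1) →₀ ℕ) : key a 0 = a.degree := by
  have h : Finset.Iic (Fin.rev (0 : Fin (n + 1))) = Finset.univ := by
    ext i
    simp [Fin.le_last]
  rw [key_apply, h, Finsupp.degree_eq_sum]

theorem key_castSucc (a : Fin (n + 1) →₀ ℕ) (k : Fin n) :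
    key a k.castSucc = key a k.succ + a (Fin.rev k.castSucc) := by
  have h : Finset.Iic (Fin.rev k.castSucc)
      = insert (Fin.rev k.castSucc) (Finset.Iic (Fin.rev k.succ)) := by
    ext i
    simp only [Finset.mem_Iic, Finset.mem_insert, Fin.le_def, Fin.ext_iff, Fin.val_rev,
      Fin.val_castSucc, Fin.val_succ]
    omega
  have h' : Fin.rev k.castSucc ∉ Finset.Iic (Fin.rev k.succ) := by
    simp only [Finset.mem_Iic, Fin.le_def, Fin.val_rev, Fin.val_castSucc, Fin.val_succ]
    omega
  rw [key_apply, h, Finset.sum_insert h', key_apply, add_comm]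

theorem key_last (a : Fin (n + 1) →₀ ℕ) : key a (Fin.last n) = a 0 := by
  have h : Finset.Iic (Fin.rev (Fin.last n)) = {0} := by
    ext i
    simp
  rw [key_apply, h, Finset.sum_singleton]

theorem key_injective : Function.Injective (key (n := n)) := by
  intro a b h
  ext i
  rcases Fin.eq_zero_or_eq_succ i with rfl | ⟨j, rfl⟩
  · rw [← key_last, ← key_last, h]
  · have e : (j.succ : Fin (n + 1)) = Fin.rev (Fin.rev j).castSucc := by
      rw [Fin.rev_castSucc, Fin.rev_rev]
    have ha := key_castSucc a (Fin.rev j)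
    have hb := key_castSucc b (Fin.rev j)
    rw [e]
    rw [h] at ha
    omega

noncomputable instance : LinearOrder (GRevLexExp n) :=
  LinearOrder.lift' (key (n := n)) key_injective

theorem lt_iff_key {a b : GRevLexExp n} : a < b ↔ key (n := n) a < key (n := n) b := Iff.rfl

theorem le_iff_key {a b : GRevLexExp n} : a ≤ b ↔ key (n := n) a ≤ key (n := n) b := Iff.rfl

instance : IsOrderedAddMonoid (GRevLexExp n) where
  add_le_add_left a b h c := by
    rw [le_iff_key] at h ⊢
    have e (x y : GRevLexExp n) : key (n := n) (x + y) = key (n := n) x + key (n := n) y :=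
      key_add _ _
    rw [e, e]
    exact add_le_add_left h _

instance : WellFoundedLT (GRevLexExp n) :=
  ⟨InvImage.wf (key (n := n)) (wellFounded_lt (α := Lex (Fin (n + 1) → ℕ)))⟩

end GRevLexExp

/-- The graded reverse lexicographic order on the monomials in `t_1, …, t_{n+1}`. -/
noncomputable def MonomialOrder.grevLex (n : ℕ) : MonomialOrder (Fin (n + 1)) where
  syn := GRevLexExp n
  toSyn :=
    { toFun := fun a => a
      invFun := fun a => a
      left_inv := fun _ => rfl
      right_inv := fun _ => rfl
      map_add' := fun _ _ => rfl }
  toSyn_monotone := by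
    intro a b h
    exact Pi.toLex_monotone fun k => Finset.sum_le_sum fun i _ => h i

/-- `t^a ≺ t^b` if and only if `deg t^a < deg t^b`, or the degrees agree and the last non-zero
entry of `b - a` is negative. -/
theorem MonomialOrder.grevLex_lt_iff {n : ℕ} {a b : Fin (n + 1) →₀ ℕ} :
    (MonomialOrder.grevLex n).toSyn a < (MonomialOrder.grevLex n).toSyn b ↔
      a.degree < b.degree ∨
        (a.degree = b.degree ∧ ∃ i, (∀ j, i < j → a j = b j) ∧ b i < a i) := by
  have step : (MonomialOrder.grevLex n).toSyn a < (MonomialOrder.grevLex n).toSyn b ↔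
      ∃ k, (∀ j, j < k → GRevLexExp.key a j = GRevLexExp.key b j) ∧
        GRevLexExp.key a k < GRevLexExp.key b k := Iff.rfl
  rw [step, ← GRevLexExp.key_zero_eq_degree, ← GRevLexExp.key_zero_eq_degree]
  constructor
  · rintro ⟨k, hk, hlt⟩
    rcases Fin.eq_zero_or_eq_succ k with rfl | ⟨l, rfl⟩
    · exact Or.inl hlt
    · refine Or.inr ⟨hk 0 (Fin.succ_pos l), Fin.rev l.castSucc, ?_, ?_⟩
      · intro j hj
        have hjn : (Fin.rev j).val < n := by
          have := l.isLt
          simp only [Fin.lt_def, Fin.val_rev, Fin.val_castSucc] at hj ⊢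
          omega
        have e : j = Fin.rev (Fin.castSucc ⟨(Fin.rev j).val, hjn⟩) := by
          ext
          have := j.isLt
          simp only [Fin.val_rev, Fin.val_castSucc]
          omega
        have ha := GRevLexExp.key_castSucc a ⟨(Fin.rev j).val, hjn⟩
        have hb := GRevLexExp.key_castSucc b ⟨(Fin.rev j).val, hjn⟩
        rw [← e] at ha hb
        have h1 := hk (Fin.castSucc ⟨(Fin.rev j).val, hjn⟩) (by
          simp only [Fin.lt_def, Fin.val_rev, Fin.val_castSucc, Fin.val_succ] at hj ⊢
          omega)
        have h2 := hk (Fin.succ ⟨(Fin.rev j).val, hjn⟩) (by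
          simp only [Fin.lt_def, Fin.val_rev, Fin.val_castSucc, Fin.val_succ] at hj ⊢
          omega)
        omega
      · have ha := GRevLexExp.key_castSucc a l
        have hb := GRevLexExp.key_castSucc b l
        have h1 := hk l.castSucc Fin.castSucc_lt_succ
        omega
  · rintro (h | ⟨h0, i, hi, hlt⟩)
    · exact ⟨0, fun j hj => absurd hj (Fin.not_lt_zero j), h⟩
    · have aux : ∀ k : Fin (n + 1), k ≤ Fin.rev i → GRevLexExp.key a k = GRevLexExp.key b k := by
        intro k
        induction k using Fin.induction with
        | zero => exact fun _ => h0
        | succ l ih =>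
          intro hl
          have hl' : l.castSucc ≤ Fin.rev i := le_trans (le_of_lt Fin.castSucc_lt_succ) hl
          have ha := GRevLexExp.key_castSucc a l
          have hb := GRevLexExp.key_castSucc b l
          have h1 := ih hl'
          have h2 := hi (Fin.rev l.castSucc) (by
            simp only [Fin.lt_def, Fin.le_def, Fin.val_rev, Fin.val_castSucc, Fin.val_succ] at hl ⊢
            omega)
          omega
      rcases Fin.eq_zero_or_eq_succ i with rfl | ⟨j, rfl⟩
      · have := aux (Fin.last n) (by simp)
        rw [GRevLexExp.key_last, GRevLexExp.key_last] at this
        omega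
      · have e : (j.succ : Fin (n + 1)) = Fin.rev (Fin.rev j).castSucc := by
          rw [Fin.rev_castSucc, Fin.rev_rev]
        have e' : Fin.rev j.succ = (Fin.rev j).castSucc := Fin.rev_succ j
        refine ⟨(Fin.rev j).succ, fun k hk => aux k ?_, ?_⟩
        · rw [e']
          simp only [Fin.lt_def, Fin.le_def, Fin.val_castSucc, Fin.val_succ] at hk ⊢
          omega
        · have ha := GRevLexExp.key_castSucc a (Fin.rev j)
          have hb := GRevLexExp.key_castSucc b (Fin.rev j)
          have h1 := aux (Fin.rev j).castSucc (le_of_eq e'.symm)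
          rw [← e] at ha hb
          omega

/-! ### Standard monomials -/

/-- The initial ideal `in_≺(I)`, generated by the initial monomials of the non-zero elements
of `I`. -/
noncomputable def initialIdeal {σ K : Type*} [Field K] (ord : MonomialOrder σ)
    (I : Ideal (MvPolynomial σ K)) : Ideal (MvPolynomial σ K) :=
  Ideal.span {u | ∃ f ∈ I, f ≠ 0 ∧ u = monomial (ord.degree f) 1}

/-- The footprint `Δ_≺(I)`: the (exponents of the) monomials that are not in `in_≺(I)`. -/
def footprint {σ K : Type*} [Field K] (ord : MonomialOrder σ)
    (I : Ideal (MvPolynomial σ K)) : Set (σ →₀ ℕ) :=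
  {a | monomial a (1 : K) ∉ initialIdeal ord I}

/-- `Δ_≺(I)_d`: the standard monomials of degree `d`. -/
def footprintDegree {σ K : Type*} [Field K] (ord : MonomialOrder σ)
    (I : Ideal (MvPolynomial σ K)) (d : ℕ) : Set (σ →₀ ℕ) :=
  {a | a ∈ footprint ord I ∧ a.degree = d}

/-- `KΔ_≺(I)`: the `K`-linear span of the standard monomials. -/
noncomputable def footprintSpan {σ K : Type*} [Field K] (ord : MonomialOrder σ)
    (I : Ideal (MvPolynomial σ K)) : Submodule K (MvPolynomial σ K) :=
  Submodule.span K ((fun a => monomial a (1 : K)) '' footprint ord I)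

/-! ### Minimal graded free resolutions, regularity, Gorenstein ideals -/

/-- A minimal graded free resolution `0 → F_g → ⋯ → F_1 → F_0 = S → S/I → 0` of the `S`-module
`S/I`, where `F_i = ⨁_k S(-shift i k)` has rank `rank i` and the map `F_{i+1} → F_i` is given by the
matrix `D i`. -/
structure MinimalGradedFreeResolution {σ K : Type*} [Field K] (I : Ideal (MvPolynomial σ K)) where
  /-- the rank of `F_i` -/
  rank : ℕ → ℕ
  /-- the degrees of the basis elements of `F_i` -/
  shift : (i : ℕ) → Fin (rank i) → ℕ
  /-- the matrix of `F_{i+1} → F_i` -/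
  D : (i : ℕ) → Matrix (Fin (rank i)) (Fin (rank (i + 1))) (MvPolynomial σ K)
  /-- the length `g` of the resolution, i.e. the projective dimension of `S/I` -/
  length : ℕ
  rank_length_ne_zero : rank length ≠ 0
  rank_eq_zero_of_length_lt : ∀ i, length < i → rank i = 0
  rank_zero : rank 0 = 1
  shift_zero : ∀ k, shift 0 k = 0
  /-- the maps are homogeneous of degree `0` -/
  homogeneous : ∀ i k l, D i k l ≠ 0 →
    ∃ e, e + shift i k = shift (i + 1) l ∧ (D i k l).IsHomogeneous e
  /-- minimality: `F_{i+1}` is mapped into `(t_1, …, t_s) F_i` -/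
  minimal : ∀ i k l, constantCoeff (D i k l) = 0
  /-- exactness at `F_{i+1}` -/
  exact_succ : ∀ i, Function.Exact (D (i + 1)).mulVecLin (D i).mulVecLin
  /-- exactness at `F_0 = S`: the image of `F_1 → S` is `I` -/
  exact_zero : ∀ f, f ∈ I ↔ (fun _ => f) ∈ LinearMap.range (D 0).mulVecLin

/-- The graded Betti number `b_{i,j}`: the number of summands `S(-j)` of `F_i`. -/
def MinimalGradedFreeResolution.betti {σ K : Type*} [Field K] {I : Ideal (MvPolynomial σ K)}
    (F : MinimalGradedFreeResolution I) (i j : ℕ) : ℕ :=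
  (Finset.univ.filter fun k => F.shift i k = j).card

/-- The Castelnuovo–Mumford regularity `reg(S/I) = max {j - i | b_{i,j} ≠ 0}`. The minimal graded
free resolution is unique up to isomorphism, so that it does not matter which one is used. -/
noncomputable def quotientRegularity {σ K : Type*} [Field K] (I : Ideal (MvPolynomial σ K)) : ℕ :=
  sSup {r | ∃ (F : MinimalGradedFreeResolution I) (i j : ℕ), F.betti i j ≠ 0 ∧ j = r + i}

/-- `I` is Gorenstein: in the last step `g` of the minimal graded free resolution of `S/I` there is
a unique `j` with `b_{g,j} ≠ 0`, and `b_{g,j} = 1`. -/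
def IsGorensteinIdeal {σ K : Type*} [Field K] (I : Ideal (MvPolynomial σ K)) : Prop :=
  ∃ (F : MinimalGradedFreeResolution I) (j : ℕ),
    F.betti F.length j = 1 ∧ ∀ j', F.betti F.length j' ≠ 0 → j' = j

/-! ### Projective points, indicator functions, codes -/

/-- The graded vanishing ideal of the projective points with representatives `P i`: the ideal
generated by the homogeneous polynomials that vanish at all of them. -/
noncomputable def gradedVanishingIdeal {σ K ι : Type*} [Field K] (P : ι → σ → K) : Ideal (MvPolynomial σ K) :=
  Ideal.span {f | (∃ d, f.IsHomogeneous d) ∧ ∀ i, eval (P i) f = 0}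

/-- The vanishing ideal `𝔭` of a single projective point with representative `p`. -/
noncomputable def pointIdeal {σ K : Type*} [Field K] (p : σ → K) : Ideal (MvPolynomial σ K) :=
  gradedVanishingIdeal fun _ : Unit => p

/-- The v-number of `I` at `𝔭`: `v_𝔭(I) = min {d | ∃ f ∈ S_d, (I : f) = 𝔭}`. -/
noncomputable def vNumber {σ K : Type*} [Field K] (I 𝔭 : Ideal (MvPolynomial σ K)) : ℕ :=
  sInf {d | ∃ f : MvPolynomial σ K, f.IsHomogeneous d ∧ I.colon {f} = 𝔭}

/-- `f` is an indicator function of `[P i]`. -/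
def IsIndicatorFunction {σ K ι : Type*} [Field K] (P : ι → σ → K) (i : ι)
    (f : MvPolynomial σ K) : Prop :=
  (∃ d, f.IsHomogeneous d) ∧ eval (P i) f ≠ 0 ∧ ∀ j, j ≠ i → eval (P j) f = 0

/-- `f` is the `i`-th standard indicator function: the indicator function of `[P i]` in `KΔ_≺(I)` of
degree `v_{𝔭_i}(I)`, which is unique up to multiplication by a non-zero scalar. -/
def IsStandardIndicatorFunction {σ K ι : Type*} [Field K] (ord : MonomialOrder σ) (P : ι → σ → K)
    (i : ι) (f : MvPolynomial σ K) : Prop :=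
  IsIndicatorFunction P i f ∧ f ∈ footprintSpan ord (gradedVanishingIdeal P) ∧
    f.IsHomogeneous (vNumber (gradedVanishingIdeal P) (pointIdeal (P i)))

/-- `t^a` is essential: it is a standard monomial that appears in each standard indicator function
`f_i`. -/
def IsEssentialMonomial {σ K ι : Type*} [Field K] (ord : MonomialOrder σ) (P : ι → σ → K)
    (a : σ →₀ ℕ) : Prop :=
  a ∈ footprint ord (gradedVanishingIdeal P) ∧
    ∀ i f, IsStandardIndicatorFunction ord P i f → coeff a f ≠ 0

/-- The evaluation map `f ↦ (f(P_i))_i`. -/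
noncomputable def evaluationMap {σ K ι : Type*} [Field K] (P : ι → σ → K) :
    MvPolynomial σ K →ₗ[K] (ι → K) :=
  LinearMap.pi fun i => (aeval (P i)).toLinearMap

/-- The projective Reed–Muller-type code `C_𝕏(d)`: the image of `S_d` under evaluation. -/
noncomputable def reedMullerCode {σ K ι : Type*} [Field K] (P : ι → σ → K) (d : ℕ) :
    Submodule K (ι → K) :=
  (homogeneousSubmodule σ K d).map (evaluationMap P)

/-- `H` is a parity check matrix of the linear code `C`: its rows are linearly independent and
`C = {x | H x = 0}`. -/
def IsParityCheckMatrix {K ι κ : Type*} [Field K] [Fintype ι] (H : Matrix κ ι K)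
    (C : Submodule K (ι → K)) : Prop :=
  LinearIndependent K H.row ∧ ∀ x, x ∈ C ↔ H.mulVec x = 0

/-! ### Complexes of free modules modulo an ideal -/

/-! Write A = S/(I, t_s). The argument is that the socle of A is a line spanned by the class of any
f_i, and that the same line is spanned by a single standard monomial.

Homological side. Reduce a minimal resolution F of S/I modulo the last k+1 variables, with s = n+1.
Since t_s is regular on S/I, the homology of F modulo t_s is A, concentrated in degree 0. Killing
one more variable at a time, the long exact sequence has a connecting map that embeds the socle of
the k-th homology modulo k+1 variables into the socle of the (k+1)-st homology modulo k+2 variables.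
After all variables are killed, minimality makes the differentials zero, so the socle of A embeds in
K^(rank F_n). The same sequences give rank F_i = 0 for i > n, so the Gorenstein condition forces
rank F_n ≤ 1 and the socle of A has dimension at most one
(`IsGorensteinIdeal.exists_socle_relation`). Every connecting map raises the degree by one; hence
the top degree of A is reg(S/I) (`quotientRegularity_eq`).

Geometric side. Each t_k f_i agrees on all points with a multiple of t_s f_i, so f_i is a socle
element of A; it is non-zero there because its degree is minimal. All f_i therefore have one common
degree. It is the top degree of A, as any form is modulo I a combination of the f_i times powers of
t_s once its degree allows it. So this degree is r_0.

Gröbner side. For GRevLex, standard monomials of one degree that are free of t_s are independent in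
A (`eq_zero_of_mem_sup`). In degree r_0 they lie in the socle, so there is at most one, t^a; each
f_i must contain it, being outside (t_s). For the code, compare coefficients of t^a in combinations
of the f_i: such a combination comes from t_s times a form of degree r_0 - 1 exactly when that
coefficient vanishes. -/

section ModComplex

variable {R : Type*} [CommRing R] {r : ℕ → ℕ}
  (D : (i : ℕ) → Matrix (Fin (r i)) (Fin (r (i + 1))) R)

/-- All entries of `v` lie in the ideal `J`. -/
def EntriesMem (J : Ideal R) {k : ℕ} (v : Fin k → R) : Prop := ∀ i, v i ∈ J

/-- `v ∈ R^{r i}` is a cycle modulo `J`. -/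
def IsCycleMod (J : Ideal R) : (i : ℕ) → (Fin (r i) → R) → Prop
  | 0, _ => True
  | i + 1, v => EntriesMem J ((D i).mulVec v)

/-- `v ∈ R^{r i}` is a boundary modulo `J`. -/
def IsBoundaryMod (J : Ideal R) (i : ℕ) (v : Fin (r i) → R) : Prop :=
  ∃ y, EntriesMem J (v - (D i).mulVec y)

variable {D} {J : Ideal R}

theorem EntriesMem.add {k : ℕ} {v w : Fin k → R} (hv : EntriesMem J v) (hw : EntriesMem J w) :
    EntriesMem J (v + w) := fun i => J.add_mem (hv i) (hw i)

theorem EntriesMem.sub {k : ℕ} {v w : Fin k → R} (hv : EntriesMem J v) (hw : EntriesMem J w) :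
    EntriesMem J (v - w) := fun i => J.sub_mem (hv i) (hw i)

theorem EntriesMem.smul {k : ℕ} {v : Fin k → R} (c : R) (hv : EntriesMem J v) :
    EntriesMem J (c • v) := fun i => J.mul_mem_left c (hv i)

theorem EntriesMem.mono {J' : Ideal R} (h : J ≤ J') {k : ℕ} {v : Fin k → R}
    (hv : EntriesMem J v) : EntriesMem J' v := fun i => h (hv i)

theorem EntriesMem.mulVec {k l : ℕ} (M : Matrix (Fin k) (Fin l) R) {v : Fin l → R}
    (hv : EntriesMem J v) : EntriesMem J (M.mulVec v) :=
  fun i => show ∑ j, M i j * v j ∈ J from J.sum_mem fun j _ => J.mul_mem_left _ (hv j)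

theorem EntriesMem.exists_add_smul {x : R} {k : ℕ} {v : Fin k → R}
    (hv : EntriesMem (J ⊔ Ideal.span {x}) v) : ∃ w, EntriesMem J (v - x • w) := by
  have h : ∀ i, ∃ w, v i - x * w ∈ J := by
    intro i
    obtain ⟨a, ha, b, hb, hab⟩ := Submodule.mem_sup.1 (hv i)
    obtain ⟨w, rfl⟩ := Ideal.mem_span_singleton'.1 hb
    exact ⟨w, by rwa [← hab, mul_comm x w, add_sub_cancel_right]⟩
  choose w hw using h
  exact ⟨w, hw⟩

theorem EntriesMem.smul_sup (x : R) {k : ℕ} (v : Fin k → R) :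
    EntriesMem (J ⊔ Ideal.span {x}) (x • v) := fun _ =>
  Ideal.mem_sup_right (Ideal.mul_mem_right _ _ (Ideal.mem_span_singleton_self x))

theorem IsBoundaryMod.of_add_smul {x : R} {i : ℕ} {v y : Fin (r i) → R}
    (h : IsBoundaryMod D J i (v - x • y)) : IsBoundaryMod D (J ⊔ Ideal.span {x}) i v := by
  obtain ⟨z, hz⟩ := h
  refine ⟨z, ?_⟩
  have := (hz.mono (le_sup_left (b := Ideal.span {x}))).add (EntriesMem.smul_sup (J := J) x y)
  convert this using 1
  abel

/-- A cycle modulo `J + (x)` maps to `x` times a cycle modulo `J`. -/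
theorem IsCycleMod.exists_connecting
    (hDD : ∀ i (v : Fin (r (i + 2)) → R), (D i).mulVec ((D (i + 1)).mulVec v) = 0)
    {x : R} (hx : ∀ a, x * a ∈ J → a ∈ J) {i : ℕ} {v : Fin (r (i + 1)) → R}
    (hv : IsCycleMod D (J ⊔ Ideal.span {x}) (i + 1) v) :
    ∃ w, IsCycleMod D J i w ∧ EntriesMem J ((D i).mulVec v - x • w) := by
  obtain ⟨w, hw⟩ := EntriesMem.exists_add_smul hv
  refine ⟨w, ?_, hw⟩
  cases i with
  | zero => trivial
  | succ i =>
    -- Applying D to D v ≡ x w gives x D w ≡ 0 modulo J, and x can be cancelled.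
    intro k
    apply hx
    have h := hw.mulVec (D i) k
    rw [Matrix.mulVec_sub, hDD, zero_sub, Matrix.mulVec_smul] at h
    simpa using J.neg_mem h

/-- Acyclicity passes from `J` to `J + (x)`, in one degree higher. -/
theorem isBoundaryMod_sup_of_connecting
    (hDD : ∀ i (v : Fin (r (i + 2)) → R), (D i).mulVec ((D (i + 1)).mulVec v) = 0)
    {x : R} (hx : ∀ a, x * a ∈ J → a ∈ J) {i : ℕ}
    (h₁ : ∀ v, IsCycleMod D J (i + 1) v → IsBoundaryMod D J (i + 1) v)
    (h₀ : ∀ w, IsCycleMod D J i w → IsBoundaryMod D J i (x • w) → IsBoundaryMod D J i w)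
    (v : Fin (r (i + 1)) → R) (hv : IsCycleMod D (J ⊔ Ideal.span {x}) (i + 1) v) :
    IsBoundaryMod D (J ⊔ Ideal.span {x}) (i + 1) v := by
  obtain ⟨w, hw, hvw⟩ := hv.exists_connecting hDD hx
  have hxw : IsBoundaryMod D J i (x • w) := ⟨v, by
    have := hvw.smul (-1)
    simpa using this⟩
  obtain ⟨y, hy⟩ := h₀ w hw hxw
  refine IsBoundaryMod.of_add_smul (y := y) (h₁ _ ?_)
  have := hvw.add (hy.smul x)
  change EntriesMem J _
  convert this using 1
  rw [Matrix.mulVec_sub, Matrix.mulVec_smul, smul_sub]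
  abel

/-- The graded version: acyclicity of the parts selected by `π` passes from `J` to `J + (x)`. -/
theorem isBoundaryMod_proj_sup
    (hDD : ∀ i (v : Fin (r (i + 2)) → R), (D i).mulVec ((D (i + 1)).mulVec v) = 0)
    {x : R} (hx : ∀ a, x * a ∈ J → a ∈ J)
    (π : (d i : ℕ) → (Fin (r i) → R) → (Fin (r i) → R))
    (hπsub : ∀ d i v w, π d i (v - w) = π d i v - π d i w)
    (hππ : ∀ d i v, π d i (π d i v) = π d i v)
    (hπD : ∀ d i v, π d i ((D i).mulVec v) = (D i).mulVec (π d (i + 1) v))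
    (hπJ : ∀ d i v, EntriesMem J v → EntriesMem J (π d i v))
    (hπx : ∀ d i v, π (d + 1) i (x • v) = x • π d i v) {i d : ℕ}
    (h₁ : ∀ v, IsCycleMod D J (i + 1) v → IsBoundaryMod D J (i + 1) (π (d + 1) (i + 1) v))
    (h₀ : ∀ w, IsCycleMod D J i w → IsBoundaryMod D J i (π d i w))
    (v : Fin (r (i + 1)) → R) (hv : IsCycleMod D (J ⊔ Ideal.span {x}) (i + 1) v) :
    IsBoundaryMod D (J ⊔ Ideal.span {x}) (i + 1) (π (d + 1) (i + 1) v) := by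
  obtain ⟨w, hw, hvw⟩ := hv.exists_connecting hDD hx
  obtain ⟨y, hy⟩ := h₀ w hw
  -- Only the selected part of w is a boundary, so v must be projected before it is corrected by x
  -- y.
  have hc : IsCycleMod D J (i + 1) (π (d + 1) (i + 1) v - x • y) := by
    have := (hπJ (d + 1) _ _ hvw).add (hy.smul x)
    change EntriesMem J _
    convert this using 1
    rw [hπsub, hπD, hπx, Matrix.mulVec_sub, Matrix.mulVec_smul, smul_sub]
    abel
  have := h₁ _ hc
  rw [hπsub, hππ, hπx] at this
  exact this.of_add_smul

/-- A cycle modulo `J` whose class is annihilated by all elements of `T`. -/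
def IsSocleCycleMod (D : (i : ℕ) → Matrix (Fin (r i)) (Fin (r (i + 1))) R) (J : Ideal R)
    (T : Set R) (i : ℕ) (v : Fin (r i) → R) : Prop :=
  IsCycleMod D J i v ∧ ∀ t ∈ T, IsBoundaryMod D J i (t • v)

/-- Lifting along the connecting map. -/
theorem IsSocleCycleMod.exists_lift {x : R} {T : Set R} (hxT : x ∈ T) {i : ℕ}
    (h₁ : ∀ v, IsCycleMod D J (i + 1) v → IsBoundaryMod D J (i + 1) v)
    {v : Fin (r i) → R} (hv : IsSocleCycleMod D J T i v) :
    ∃ w, IsSocleCycleMod D (J ⊔ Ideal.span {x}) T (i + 1) w ∧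
      EntriesMem J (x • v - (D i).mulVec w) := by
  -- As x kills the class of v, x v is the boundary of some w modulo J. This w is a cycle modulo J +
  -- (x), and the connecting map sends its class to that of v.
  obtain ⟨w, hw⟩ := hv.2 x hxT
  refine ⟨w, ⟨?_, fun t ht => ?_⟩, hw⟩
  · have := (EntriesMem.smul_sup (J := J) x v).sub (hw.mono le_sup_left)
    change EntriesMem _ _
    convert this using 1
    abel
  -- With t v ≡ D y, the difference t w - x y is a cycle modulo J, hence a boundary.
  · obtain ⟨y, hy⟩ := hv.2 t ht
    refine IsBoundaryMod.of_add_smul (y := y) (h₁ _ ?_)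
    have := (hy.smul x).sub (hw.smul t)
    change EntriesMem _ _
    convert this using 1
    rw [Matrix.mulVec_sub, Matrix.mulVec_smul, Matrix.mulVec_smul, smul_sub, smul_sub,
      smul_comm x t]
    abel

/-- The connecting map reflects boundaries. -/
theorem IsBoundaryMod.of_lift
    (hDD : ∀ i (v : Fin (r (i + 2)) → R), (D i).mulVec ((D (i + 1)).mulVec v) = 0)
    {x : R} (hx : ∀ a, x * a ∈ J → a ∈ J) {i : ℕ} {v : Fin (r i) → R} {w : Fin (r (i + 1)) → R}
    (hvw : EntriesMem J (x • v - (D i).mulVec w))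
    (hw : IsBoundaryMod D (J ⊔ Ideal.span {x}) (i + 1) w) : IsBoundaryMod D J i v := by
  obtain ⟨z, hz⟩ := hw
  obtain ⟨y, hy⟩ := hz.exists_add_smul
  refine ⟨y, fun k => hx _ ?_⟩
  have h := hvw.add (hy.mulVec (D i)) k
  rw [Matrix.mulVec_sub, Matrix.mulVec_sub, hDD, Matrix.mulVec_smul] at h
  convert h using 1
  simp [mul_sub]

end ModComplex

/-! ### Homogeneous components and variable ideals -/

section Components

attribute [local instance] MvPolynomial.gradedAlgebra

variable {σ K : Type*} [Field K]

theorem coe_decompose_eq_homogeneousComponent (p : MvPolynomial σ K) (d : ℕ) :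
    (DirectSum.decompose (homogeneousSubmodule σ K) p d : MvPolynomial σ K)
      = homogeneousComponent d p :=
  decomposition.decompose'_apply p d

theorem homogeneousComponent_mul_of_le {φ : MvPolynomial σ K} {e d : ℕ} (hφ : φ.IsHomogeneous e)
    (h : e ≤ d) (p : MvPolynomial σ K) :
    homogeneousComponent d (φ * p) = φ * homogeneousComponent (d - e) p := by
  rw [← coe_decompose_eq_homogeneousComponent, ← coe_decompose_eq_homogeneousComponent]
  exact DirectSum.coe_decompose_mul_of_left_mem_of_le _ hφ h

theorem homogeneousComponent_mul_of_not_le {φ : MvPolynomial σ K} {e d : ℕ}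
    (hφ : φ.IsHomogeneous e) (h : ¬e ≤ d) (p : MvPolynomial σ K) :
    homogeneousComponent d (φ * p) = 0 := by
  rw [← coe_decompose_eq_homogeneousComponent]
  exact DirectSum.coe_decompose_mul_of_left_mem_of_not_le _ hφ h

theorem homogeneousComponent_succ_X_mul (i : σ) (d : ℕ) (p : MvPolynomial σ K) :
    homogeneousComponent (d + 1) (X i * p) = X i * homogeneousComponent d p :=
  homogeneousComponent_mul_of_le (isHomogeneous_X K i) (Nat.le_add_left 1 d) p

theorem homogeneousComponent_zero_X_mul (i : σ) (p : MvPolynomial σ K) :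
    homogeneousComponent 0 (X i * p) = 0 :=
  homogeneousComponent_mul_of_not_le (isHomogeneous_X K i) (by simp) p

end Components

/-- The ideal generated by the last `k` variables. -/
noncomputable def lastVarsIdeal (K : Type*) [Field K] (n k : ℕ) :
    Ideal (MvPolynomial (Fin (n + 1)) K) :=
  Ideal.span (X '' {i : Fin (n + 1) | n < i + k})

section LastVars

variable {K : Type*} [Field K] {n : ℕ}

theorem lastVarsIdeal_zero : lastVarsIdeal K n 0 = ⊥ := by
  have : {i : Fin (n + 1) | n < i + 0} = ∅ := by
    ext i
    have := i.isLt
    simp only [Set.mem_ofPred_eq, Set.mem_empty_iff_false, iff_false]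
    omega
  rw [lastVarsIdeal, this, Set.image_empty, Ideal.span_empty]

theorem lastVarsIdeal_succ {k : ℕ} (hk : k < n + 1) :
    lastVarsIdeal K n (k + 1) = lastVarsIdeal K n k ⊔ Ideal.span {X (Fin.rev ⟨k, hk⟩)} := by
  have : {i : Fin (n + 1) | n < i + (k + 1)}
      = {i : Fin (n + 1) | n < i + k} ∪ {Fin.rev ⟨k, hk⟩} := by
    ext i
    have := i.isLt
    simp only [Set.mem_ofPred_eq, Set.union_singleton, Set.mem_insert_iff, Fin.ext_iff, Fin.val_rev]
    omega
  rw [lastVarsIdeal, this, Set.image_union, Ideal.span_union, Set.image_singleton, lastVarsIdeal]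

theorem lastVarsIdeal_one : lastVarsIdeal K n 1 = Ideal.span {X (Fin.last n)} := by
  have := lastVarsIdeal_succ (K := K) (Nat.succ_pos n)
  rwa [lastVarsIdeal_zero, bot_sup_eq] at this

/-- With k = n + 1 every variable is included, so the ideal is the irrelevant maximal ideal.
Minimality of a resolution is used in this form. -/
theorem constantCoeff_eq_zero_iff_mem_lastVarsIdeal {p : MvPolynomial (Fin (n + 1)) K} :
    constantCoeff p = 0 ↔ p ∈ lastVarsIdeal K n (n + 1) := by
  rw [lastVarsIdeal, mem_ideal_span_X_image]
  constructor
  · intro h m hm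
    by_contra! hc
    have : m = 0 := by
      ext i
      exact hc i (by simp only [Set.mem_ofPred_eq]; omega)
    rw [this, mem_support_iff] at hm
    exact hm h
  · intro h
    by_contra hc
    obtain ⟨i, -, hi⟩ := h 0 (by rwa [mem_support_iff])
    exact hi rfl

/-- The variables, taken from the last one backwards, form a regular sequence on S; this supplies
the cancellation hypothesis of the connecting maps. -/
theorem mem_lastVarsIdeal_of_X_mul_mem {k : ℕ} (hk : k < n + 1)
    (p : MvPolynomial (Fin (n + 1)) K) (h : X (Fin.rev ⟨k, hk⟩) * p ∈ lastVarsIdeal K n k) :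
    p ∈ lastVarsIdeal K n k := by
  rw [lastVarsIdeal, mem_ideal_span_X_image] at h ⊢
  intro m hm
  obtain ⟨i, hi, hmi⟩ := h (Finsupp.single (Fin.rev ⟨k, hk⟩) 1 + m) (by
    rw [mem_support_iff, coeff_X_mul]
    exact mem_support_iff.1 hm)
  refine ⟨i, hi, ?_⟩
  have hne : Fin.rev ⟨k, hk⟩ ≠ i := by
    rintro rfl
    simp only [Set.mem_ofPred_eq, Fin.val_rev] at hi
    omega
  simpa [Finsupp.single_apply, hne] using hmi

theorem homogeneousComponent_mem_lastVarsIdeal (k d : ℕ) {p : MvPolynomial (Fin (n + 1)) K}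
    (h : p ∈ lastVarsIdeal K n k) : homogeneousComponent d p ∈ lastVarsIdeal K n k := by
  rw [lastVarsIdeal, mem_ideal_span_X_image] at h ⊢
  intro m hm
  refine h m ?_
  rw [mem_support_iff, coeff_homogeneousComponent] at hm
  rw [mem_support_iff]
  exact fun h0 => hm (by simp [h0])

end LastVars

/-! ### The resolution modulo the last variables -/

namespace MinimalGradedFreeResolution

variable {K : Type*} [Field K] {n : ℕ} {I : Ideal (MvPolynomial (Fin (n + 1)) K)}
  (F : MinimalGradedFreeResolution I)

/-- The projection of `F_i` onto its part of degree `d`. -/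
noncomputable def proj (d i : ℕ) (v : Fin (F.rank i) → MvPolynomial (Fin (n + 1)) K) :
    Fin (F.rank i) → MvPolynomial (Fin (n + 1)) K :=
  -- The guard is needed because truncated subtraction would otherwise select constants when d is
  -- below the shift.
  fun k => if F.shift i k ≤ d then homogeneousComponent (d - F.shift i k) (v k) else 0

theorem proj_sub (d i : ℕ) (v w : Fin (F.rank i) → MvPolynomial (Fin (n + 1)) K) :
    F.proj d i (v - w) = F.proj d i v - F.proj d i w := by
  ext1 k
  simp only [proj, Pi.sub_apply, map_sub]
  split_ifs <;> simp

theorem proj_proj (d i : ℕ) (v : Fin (F.rank i) → MvPolynomial (Fin (n + 1)) K) :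
    F.proj d i (F.proj d i v) = F.proj d i v := by
  ext1 k
  simp only [proj]
  split_ifs
  · exact homogeneousComponent_eq_self (homogeneousComponent_isHomogeneous _ _)
  · rfl

theorem proj_mulVec (d i : ℕ) (v : Fin (F.rank (i + 1)) → MvPolynomial (Fin (n + 1)) K) :
    F.proj d i ((F.D i).mulVec v) = (F.D i).mulVec (F.proj d (i + 1) v) := by
  ext1 k
  have h : ∀ l, (if F.shift i k ≤ d then
      homogeneousComponent (d - F.shift i k) (F.D i k l * v l) else 0)
      = F.D i k l * F.proj d (i + 1) v l := by
    intro l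
    by_cases h0 : F.D i k l = 0
    · simp [h0]
    obtain ⟨e, he, hhom⟩ := F.homogeneous i k l h0
    simp only [proj]
    split_ifs with h1 h2 h2
    · rw [homogeneousComponent_mul_of_le hhom (by omega)]
      congr 3
      omega
    · rw [homogeneousComponent_mul_of_not_le hhom (by omega), mul_zero]
    · omega
    · rw [mul_zero]
  change (if F.shift i k ≤ d then
    homogeneousComponent (d - F.shift i k) (∑ l, F.D i k l * v l) else 0)
      = ∑ l, F.D i k l * F.proj d (i + 1) v l
  rw [← Finset.sum_congr rfl fun l _ => h l]
  split_ifs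
  · exact map_sum _ _ _
  · simp

theorem proj_succ_smul (d i : ℕ) (j : Fin (n + 1))
    (v : Fin (F.rank i) → MvPolynomial (Fin (n + 1)) K) :
    F.proj (d + 1) i ((X j : MvPolynomial (Fin (n + 1)) K) • v)
      = (X j : MvPolynomial (Fin (n + 1)) K) • F.proj d i v := by
  ext1 k
  simp only [proj, Pi.smul_apply, smul_eq_mul]
  split_ifs with h1 h2 h2
  · rw [Nat.sub_add_comm h2, homogeneousComponent_succ_X_mul]
  · have : d + 1 - F.shift i k = 0 := by omega
    rw [this, homogeneousComponent_zero_X_mul, mul_zero]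
  · omega
  · rw [mul_zero]

theorem entriesMem_proj (k d i : ℕ) {v : Fin (F.rank i) → MvPolynomial (Fin (n + 1)) K}
    (hv : EntriesMem (lastVarsIdeal K n k) v) :
    EntriesMem (lastVarsIdeal K n k) (F.proj d i v) := by
  intro j
  simp only [proj]
  split_ifs
  · exact homogeneousComponent_mem_lastVarsIdeal _ _ (hv j)
  · exact zero_mem _

theorem mulVec_mulVec (i : ℕ) (v : Fin (F.rank (i + 2)) → MvPolynomial (Fin (n + 1)) K) :
    (F.D i).mulVec ((F.D (i + 1)).mulVec v) = 0 :=
  (F.exact_succ i).apply_apply_eq_zero v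

theorem isBoundaryMod_bot {i : ℕ} {v : Fin (F.rank (i + 1)) → MvPolynomial (Fin (n + 1)) K}
    (hv : IsCycleMod F.D ⊥ (i + 1) v) : IsBoundaryMod F.D ⊥ (i + 1) v := by
  obtain ⟨y, hy⟩ := (F.exact_succ i v).1 (by ext1 k; exact hv k)
  refine ⟨y, fun k => ?_⟩
  rw [← hy]
  simp

theorem isBoundaryMod_zero_iff {J : Ideal (MvPolynomial (Fin (n + 1)) K)}
    {v : Fin (F.rank 0) → MvPolynomial (Fin (n + 1)) K} (k : Fin (F.rank 0)) :
    IsBoundaryMod F.D J 0 v ↔ v k ∈ I ⊔ J := by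
  have huniq : ∀ l, l = k := fun l => by
    have := F.rank_zero
    ext
    omega
  constructor
  · rintro ⟨y, hy⟩
    have h1 : (F.D 0).mulVec y k ∈ I := by
      rw [F.exact_zero]
      refine ⟨y, ?_⟩
      ext1 l
      rw [huniq l]
      rfl
    have := Submodule.add_mem_sup h1 (hy k)
    simpa using this
  · intro h
    obtain ⟨a, ha, b, hb, hab⟩ := Submodule.mem_sup.1 h
    obtain ⟨y, hy⟩ := (F.exact_zero a).1 ha
    refine ⟨y, fun l => ?_⟩
    rw [huniq l, Pi.sub_apply, ← Matrix.mulVecLin_apply, hy, ← hab]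
    simpa using hb

/-- The index of the only basis element of `F_0`. -/
def zeroIndex : Fin (F.rank 0) := ⟨0, by rw [F.rank_zero]; exact Nat.one_pos⟩

/-- This is the vanishing of Tor_{i+1}(S/I, S/(last k+1 variables)) for k ≤ i. Regularity of t_s
starts the induction: it kills Tor_1(S/I, S/(t_s)). Each further variable shifts the range of
vanishing by one. -/
theorem isBoundaryMod_of_isCycleMod (hreg : ∀ p, X (Fin.last n) * p ∈ I → p ∈ I) {k : ℕ}
    (hk : k ≤ n) (i : ℕ) (hi : k ≤ i) (v : Fin (F.rank (i + 1)) → MvPolynomial (Fin (n + 1)) K)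
    (hv : IsCycleMod F.D (lastVarsIdeal K n (k + 1)) (i + 1) v) :
    IsBoundaryMod F.D (lastVarsIdeal K n (k + 1)) (i + 1) v := by
  induction k generalizing i v with
  | zero =>
    have hJ := lastVarsIdeal_succ (K := K) (Nat.succ_pos n)
    rw [lastVarsIdeal_zero] at hJ
    rw [hJ] at hv ⊢
    refine isBoundaryMod_sup_of_connecting F.mulVec_mulVec
      (fun a ha => ?_) (fun v hv => F.isBoundaryMod_bot hv) (fun w hw hxw => ?_) v hv
    · simpa [X_ne_zero] using ha
    · cases i with
      | zero =>
        rw [F.isBoundaryMod_zero_iff F.zeroIndex, sup_bot_eq] at hxw ⊢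
        exact hreg _ hxw
      | succ i => exact F.isBoundaryMod_bot hw
  | succ k ih =>
    have hJ := lastVarsIdeal_succ (K := K) (n := n) (k := k + 1) (by omega)
    rw [hJ] at hv ⊢
    obtain ⟨i, rfl⟩ : ∃ l, i = l + 1 := ⟨i - 1, by omega⟩
    exact isBoundaryMod_sup_of_connecting F.mulVec_mulVec
      (mem_lastVarsIdeal_of_X_mul_mem _)
      (fun v hv => ih (by omega) _ (by omega) v hv)
      (fun w hw _ => ih (by omega) _ (by omega) w hw) v hv

/-- If A vanishes above degree e, the i-th homology modulo the last variables vanishes above degree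
e + i: the connecting map lowers both the homological and the internal degree by one. -/
theorem isBoundaryMod_proj (hreg : ∀ p, X (Fin.last n) * p ∈ I → p ∈ I) {e : ℕ}
    (he : ∀ d, e < d → ∀ p : MvPolynomial (Fin (n + 1)) K, p.IsHomogeneous d →
      p ∈ I ⊔ Ideal.span {X (Fin.last n)}) {k : ℕ} (hk : k ≤ n) (i d : ℕ) (hd : e + i < d)
    (v : Fin (F.rank i) → MvPolynomial (Fin (n + 1)) K)
    (hv : IsCycleMod F.D (lastVarsIdeal K n (k + 1)) i v) :
    IsBoundaryMod F.D (lastVarsIdeal K n (k + 1)) i (F.proj d i v) := by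
  induction k generalizing i d v with
  | zero =>
    cases i with
    | zero =>
      rw [F.isBoundaryMod_zero_iff F.zeroIndex, zero_add, lastVarsIdeal_one]
      refine he d (by omega) _ ?_
      simp only [proj, F.shift_zero, Nat.zero_le, if_true, Nat.sub_zero]
      exact homogeneousComponent_isHomogeneous _ _
    | succ i =>
      obtain ⟨y, hy⟩ := F.isBoundaryMod_of_isCycleMod hreg hk i (Nat.zero_le i) v hv
      refine ⟨F.proj d (i + 2) y, ?_⟩
      have := F.entriesMem_proj _ d _ hy
      rwa [proj_sub, proj_mulVec] at this
  | succ k ih =>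
    have hJ := lastVarsIdeal_succ (K := K) (n := n) (k := k + 1) (by omega)
    rw [hJ] at hv ⊢
    cases i with
    | zero =>
      obtain ⟨y, hy⟩ := ih (by omega) 0 d hd v trivial
      exact ⟨y, hy.mono le_sup_left⟩
    | succ i =>
      obtain ⟨d, rfl⟩ : ∃ d', d = d' + 1 := ⟨d - 1, by omega⟩
      exact isBoundaryMod_proj_sup F.mulVec_mulVec
        (mem_lastVarsIdeal_of_X_mul_mem _) F.proj F.proj_sub F.proj_proj
        F.proj_mulVec (fun d i v hv => F.entriesMem_proj _ d i hv)
        (fun d i v => F.proj_succ_smul d i _ v) (ih (by omega) _ _ (by omega))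
        (ih (by omega) _ _ (by omega)) v hv

theorem isCycleMod_lastVarsIdeal (i : ℕ) (v : Fin (F.rank i) → MvPolynomial (Fin (n + 1)) K) :
    IsCycleMod F.D (lastVarsIdeal K n (n + 1)) i v := by
  cases i with
  | zero => trivial
  | succ i =>
    intro k
    change ∑ l, F.D i k l * v l ∈ _
    refine Ideal.sum_mem _ fun l _ => Ideal.mul_mem_right _ _ ?_
    rw [← constantCoeff_eq_zero_iff_mem_lastVarsIdeal]
    exact F.minimal i k l

theorem entriesMem_of_isBoundaryMod {i : ℕ} {v : Fin (F.rank i) → MvPolynomial (Fin (n + 1)) K}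
    (hv : IsBoundaryMod F.D (lastVarsIdeal K n (n + 1)) i v) :
    EntriesMem (lastVarsIdeal K n (n + 1)) v := by
  obtain ⟨y, hy⟩ := hv
  have := hy.add (F.isCycleMod_lastVarsIdeal (i + 1) y)
  simpa using this

theorem one_notMem_lastVarsIdeal :
    (1 : MvPolynomial (Fin (n + 1)) K) ∉ lastVarsIdeal K n (n + 1) := by
  rw [← constantCoeff_eq_zero_iff_mem_lastVarsIdeal]
  simp

/-- Modulo all variables every vector is a cycle, but no boundary has a unit entry; acyclicity above
degree n then excludes the all-ones vector. -/
theorem rank_eq_zero (hreg : ∀ p, X (Fin.last n) * p ∈ I → p ∈ I) {i : ℕ} (hi : n < i) :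
    F.rank i = 0 := by
  obtain ⟨i, rfl⟩ : ∃ l, i = l + 1 := ⟨i - 1, by omega⟩
  by_contra h
  exact one_notMem_lastVarsIdeal (F.entriesMem_of_isBoundaryMod
    (F.isBoundaryMod_of_isCycleMod hreg le_rfl i (by omega) 1 (F.isCycleMod_lastVarsIdeal _ 1))
    ⟨0, Nat.pos_of_ne_zero h⟩)

/-- A basis element of larger degree would be a cycle modulo all variables in a degree without
homology, hence a boundary, contradicting minimality. -/
theorem shift_le (hreg : ∀ p, X (Fin.last n) * p ∈ I → p ∈ I) {e : ℕ}
    (he : ∀ d, e < d → ∀ p : MvPolynomial (Fin (n + 1)) K, p.IsHomogeneous d →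
      p ∈ I ⊔ Ideal.span {X (Fin.last n)}) (i : ℕ) (k : Fin (F.rank i)) :
    F.shift i k ≤ e + i := by
  by_contra! h
  have h1 := F.entriesMem_of_isBoundaryMod (F.isBoundaryMod_proj hreg he le_rfl i (F.shift i k) h 1
    (F.isCycleMod_lastVarsIdeal i 1)) k
  rw [proj, if_pos le_rfl, Nat.sub_self, Pi.one_apply,
    homogeneousComponent_eq_self (isHomogeneous_one _ _)] at h1
  exact one_notMem_lastVarsIdeal h1

/-- A relation between the classes of `u` and `v`. -/
theorem exists_linear_relation (hreg : ∀ p, X (Fin.last n) * p ∈ I → p ∈ I)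
    (hrank : F.rank n ≤ 1) {k : ℕ} (hk : k ≤ n)
    {u v : Fin (F.rank k) → MvPolynomial (Fin (n + 1)) K}
    (hu : IsSocleCycleMod F.D (lastVarsIdeal K n (k + 1)) (Set.range X) k u)
    (hv : IsSocleCycleMod F.D (lastVarsIdeal K n (k + 1)) (Set.range X) k v) :
    ∃ α β : K, (α ≠ 0 ∨ β ≠ 0) ∧
      IsBoundaryMod F.D (lastVarsIdeal K n (k + 1)) k
        ((C α : MvPolynomial (Fin (n + 1)) K) • u + (C β : MvPolynomial (Fin (n + 1)) K) • v) := by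
  induction hk using Nat.decreasingInduction with
  | self =>
    rcases Nat.eq_zero_or_pos (F.rank n) with h0 | h0
    · exact ⟨1, 0, Or.inl one_ne_zero, 0, fun i => absurd i.isLt (by omega)⟩
    have huniq : ∀ l, l = (⟨0, h0⟩ : Fin (F.rank n)) := fun l => by
      ext
      simp only
      omega
    have key : ∀ α β : K, α * constantCoeff (u ⟨0, h0⟩) + β * constantCoeff (v ⟨0, h0⟩) = 0 →
        IsBoundaryMod F.D (lastVarsIdeal K n (n + 1)) n
        ((C α : MvPolynomial (Fin (n + 1)) K) • u + (C β : MvPolynomial (Fin (n + 1)) K) • v) := by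
      intro α β h
      refine ⟨0, fun l => ?_⟩
      rw [huniq l, ← constantCoeff_eq_zero_iff_mem_lastVarsIdeal]
      simpa using h
    by_cases hc : constantCoeff (v ⟨0, h0⟩) = 0
    · exact ⟨0, 1, Or.inr one_ne_zero, key _ _ (by simp [hc])⟩
    -- In rank one only the constant terms of u and v survive modulo all variables, and two scalars
    -- satisfy the crosswise relation.
    · exact ⟨constantCoeff (v ⟨0, h0⟩), -constantCoeff (u ⟨0, h0⟩), Or.inl hc,
        key _ _ (by ring)⟩
  | of_succ k hk ih =>
    have hJ := lastVarsIdeal_succ (K := K) (n := n) (k := k + 1) (by omega)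
    have hac := F.isBoundaryMod_of_isCycleMod hreg (Nat.le_of_lt hk) k le_rfl
    have hxT : X (Fin.rev (⟨k + 1, by omega⟩ : Fin (n + 1)))
      ∈ Set.range (X : Fin (n + 1) → MvPolynomial (Fin (n + 1)) K) := ⟨_, rfl⟩
    obtain ⟨u', hu', huu⟩ := hu.exists_lift hxT hac
    obtain ⟨v', hv', hvv⟩ := hv.exists_lift hxT hac
    rw [← hJ] at hu' hv'
    obtain ⟨α, β, hαβ, h⟩ := ih hu' hv'
    refine ⟨α, β, hαβ, ?_⟩
    rw [hJ] at h
    refine IsBoundaryMod.of_lift F.mulVec_mulVec (mem_lastVarsIdeal_of_X_mul_mem _)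
      ?_ h
    have := (huu.smul (C α)).add (hvv.smul (C β))
    convert this using 1
    rw [Matrix.mulVec_add, Matrix.mulVec_smul, Matrix.mulVec_smul, smul_sub, smul_sub, smul_add,
      smul_comm (C α), smul_comm (C β)]
    abel

/-- A socle class of degree e + k survives the connecting maps up to F_n ⊗ K in degree e + n. If no
generator of F_n has that degree, the class was zero from the start. -/
theorem isBoundaryMod_proj_of_shift_ne (hreg : ∀ p, X (Fin.last n) * p ∈ I → p ∈ I) {e : ℕ}
    (hshift : ∀ l, F.shift n l ≠ e + n) {k : ℕ} (hk : k ≤ n)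
    {u : Fin (F.rank k) → MvPolynomial (Fin (n + 1)) K}
    (hu : IsSocleCycleMod F.D (lastVarsIdeal K n (k + 1)) (Set.range X) k u) :
    IsBoundaryMod F.D (lastVarsIdeal K n (k + 1)) k (F.proj (e + k) k u) := by
  induction hk using Nat.decreasingInduction with
  | self =>
    refine ⟨0, fun l => ?_⟩
    have := hshift l
    rw [Matrix.mulVec_zero, sub_zero, proj, ← constantCoeff_eq_zero_iff_mem_lastVarsIdeal]
    split_ifs with h
    · rw [constantCoeff_eq, coeff_homogeneousComponent, if_neg]
      rw [map_zero]
      omega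
    · exact map_zero _
  | of_succ k hk ih =>
    have hJ := lastVarsIdeal_succ (K := K) (n := n) (k := k + 1) (by omega)
    have hac := F.isBoundaryMod_of_isCycleMod hreg (Nat.le_of_lt hk) k le_rfl
    have hxT : X (Fin.rev (⟨k + 1, by omega⟩ : Fin (n + 1)))
      ∈ Set.range (X : Fin (n + 1) → MvPolynomial (Fin (n + 1)) K) := ⟨_, rfl⟩
    obtain ⟨u', hu', huu⟩ := hu.exists_lift hxT hac
    rw [← hJ] at hu'
    have h := ih hu'
    rw [hJ] at h
    refine IsBoundaryMod.of_lift F.mulVec_mulVec (mem_lastVarsIdeal_of_X_mul_mem _)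
      ?_ h
    have := F.entriesMem_proj _ (e + k + 1) _ huu
    rwa [proj_sub, proj_succ_smul, proj_mulVec] at this

theorem isSocleCycleMod_const {p : MvPolynomial (Fin (n + 1)) K}
    (hp : ∀ i, X i * p ∈ I ⊔ Ideal.span {X (Fin.last n)}) :
    IsSocleCycleMod F.D (lastVarsIdeal K n (0 + 1)) (Set.range X) 0 fun _ => p := by
  refine ⟨trivial, ?_⟩
  rintro _ ⟨i, rfl⟩
  rw [F.isBoundaryMod_zero_iff F.zeroIndex, zero_add, lastVarsIdeal_one]
  exact hp i

theorem exists_shift_eq (hreg : ∀ p, X (Fin.last n) * p ∈ I → p ∈ I) {e : ℕ}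
    {p : MvPolynomial (Fin (n + 1)) K} (hhom : p.IsHomogeneous e)
    (hp : ∀ i, X i * p ∈ I ⊔ Ideal.span {X (Fin.last n)})
    (hp' : p ∉ I ⊔ Ideal.span {X (Fin.last n)}) : ∃ l, F.shift n l = e + n := by
  by_contra! h
  have := F.isBoundaryMod_proj_of_shift_ne hreg h (Nat.zero_le n) (F.isSocleCycleMod_const hp)
  rw [F.isBoundaryMod_zero_iff F.zeroIndex, zero_add, lastVarsIdeal_one] at this
  apply hp'
  simpa only [proj, F.shift_zero, Nat.zero_le, if_true, Nat.sub_zero, Nat.add_zero,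
    homogeneousComponent_eq_self hhom] using this

theorem betti_ne_zero_iff (i j : ℕ) : F.betti i j ≠ 0 ↔ ∃ k, F.shift i k = j := by
  simp [betti, Finset.filter_eq_empty_iff]

end MinimalGradedFreeResolution

/-! ### Socle and top degree of S/(I, t_s) -/

section Gorenstein

variable {K : Type*} [Field K] {n : ℕ} {I : Ideal (MvPolynomial (Fin (n + 1)) K)}

/-- The socle of `S/(I, t_s)` is at most one-dimensional if `I` is Gorenstein and `t_s` is regular
on `S/I`. -/
theorem IsGorensteinIdeal.exists_socle_relation (hG : IsGorensteinIdeal I)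
    (hreg : ∀ p, X (Fin.last n) * p ∈ I → p ∈ I) {p q : MvPolynomial (Fin (n + 1)) K}
    (hp : ∀ i, X i * p ∈ I ⊔ Ideal.span {X (Fin.last n)})
    (hq : ∀ i, X i * q ∈ I ⊔ Ideal.span {X (Fin.last n)}) :
    ∃ α β : K, (α ≠ 0 ∨ β ≠ 0) ∧ C α * p + C β * q ∈ I ⊔ Ideal.span {X (Fin.last n)} := by
  obtain ⟨F, j, hj, hj'⟩ := hG
  -- The length cannot exceed n; if it is smaller, F_n = 0, and if it equals n, the Gorenstein
  -- condition gives rank one.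
  have hrank : F.rank n ≤ 1 := by
    rcases lt_trichotomy F.length n with h | h | h
    · rw [F.rank_eq_zero_of_length_lt n h]
      exact Nat.zero_le 1
    · have h1 : F.rank F.length = 1 := by
        refine Eq.trans ?_ hj
        rw [MinimalGradedFreeResolution.betti, Finset.filter_true_of_mem]
        · simp
        · exact fun k _ => hj' _ ((F.betti_ne_zero_iff _ _).2 ⟨k, rfl⟩)
      exact (congrArg F.rank h.symm).trans h1 |>.le
    · exact absurd (F.rank_eq_zero hreg h) F.rank_length_ne_zero
  obtain ⟨α, β, h0, h⟩ := F.exists_linear_relation hreg hrank (Nat.zero_le n)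
    (F.isSocleCycleMod_const hp) (F.isSocleCycleMod_const hq)
  rw [F.isBoundaryMod_zero_iff F.zeroIndex, zero_add, lastVarsIdeal_one] at h
  exact ⟨α, β, h0, h⟩

/-- The regularity of `S/I` is the largest degree in which `S/(I, t_s)` does not vanish. -/
theorem quotientRegularity_eq (F : MinimalGradedFreeResolution I)
    (hreg : ∀ p, X (Fin.last n) * p ∈ I → p ∈ I) {e : ℕ}
    (he : ∀ d, e < d → ∀ p : MvPolynomial (Fin (n + 1)) K, p.IsHomogeneous d →
      p ∈ I ⊔ Ideal.span {X (Fin.last n)})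
    {p : MvPolynomial (Fin (n + 1)) K} (hhom : p.IsHomogeneous e)
    (hp : p ∉ I ⊔ Ideal.span {X (Fin.last n)}) : quotientRegularity I = e := by
  refine IsGreatest.csSup_eq ⟨?_, ?_⟩
  · have hs : ∀ i, X i * p ∈ I ⊔ Ideal.span {X (Fin.last n)} := fun i =>
      he (1 + e) (by omega) _ ((isHomogeneous_X K i).mul hhom)
    obtain ⟨l, hl⟩ := F.exists_shift_eq hreg hhom hs hp
    exact ⟨F, n, e + n, (F.betti_ne_zero_iff _ _).2 ⟨l, hl⟩, rfl⟩
  · rintro r ⟨F', i, j, hb, rfl⟩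
    obtain ⟨k, hk⟩ := (F'.betti_ne_zero_iff _ _).1 hb
    have := F'.shift_le hreg he i k
    omega

end Gorenstein

/-! ### Vanishing ideals and indicator functions -/

section VanishingIdeal

variable {σ K ι : Type*} [Field K] {P : ι → σ → K}

theorem eval_eq_zero_of_mem_gradedVanishingIdeal {f : MvPolynomial σ K}
    (hf : f ∈ gradedVanishingIdeal P) (i : ι) : eval (P i) f = 0 := by
  have : gradedVanishingIdeal P ≤ RingHom.ker (eval (P i)) :=
    Ideal.span_le.2 fun g hg => hg.2 i
  exact this hf

theorem mem_gradedVanishingIdeal_iff {f : MvPolynomial σ K} {d : ℕ} (hf : f.IsHomogeneous d) :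
    f ∈ gradedVanishingIdeal P ↔ ∀ i, eval (P i) f = 0 :=
  ⟨eval_eq_zero_of_mem_gradedVanishingIdeal, fun h => Ideal.subset_span ⟨⟨d, hf⟩, h⟩⟩

attribute [local instance] MvPolynomial.gradedAlgebra in
theorem homogeneousComponent_mem_gradedVanishingIdeal {f : MvPolynomial σ K}
    (hf : f ∈ gradedVanishingIdeal P) (d : ℕ) :
    homogeneousComponent d f ∈ gradedVanishingIdeal P :=
  homogeneousComponent_mem_of_mem (Ideal.homogeneous_span _ _ fun _ hg => hg.1) hf d

/-- Taking the degree d component makes both summands homogeneous; in degree 0 no multiple of t_j is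
left. -/
theorem exists_eq_add_X_mul {f : MvPolynomial σ K} {d : ℕ} (hf : f.IsHomogeneous d) {j : σ}
    (h : f ∈ gradedVanishingIdeal P ⊔ Ideal.span {X j}) :
    ∃ g ∈ gradedVanishingIdeal P, ∃ q : MvPolynomial σ K, f = g + X j * q ∧ g.IsHomogeneous d ∧
      (q = 0 ∨ ∃ d', d = d' + 1 ∧ q.IsHomogeneous d') := by
  obtain ⟨g, hg, b, hb, rfl⟩ := Submodule.mem_sup.1 h
  obtain ⟨q, rfl⟩ := Ideal.mem_span_singleton'.1 hb
  have hs := homogeneousComponent_eq_self hf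
  rw [map_add, mul_comm] at hs
  refine ⟨_, homogeneousComponent_mem_gradedVanishingIdeal hg d, ?_⟩
  cases d with
  | zero =>
    refine ⟨0, ?_, homogeneousComponent_isHomogeneous _ _, Or.inl rfl⟩
    rw [mul_comm, ← hs, homogeneousComponent_zero_X_mul, mul_zero]
  | succ d =>
    refine ⟨homogeneousComponent d q, ?_, homogeneousComponent_isHomogeneous _ _,
      Or.inr ⟨d, rfl, homogeneousComponent_isHomogeneous _ _⟩⟩
    rw [mul_comm, ← hs, homogeneousComponent_succ_X_mul]

theorem homogeneousComponent_mem_sup {f : MvPolynomial σ K} {j : σ}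
    (h : f ∈ gradedVanishingIdeal P ⊔ Ideal.span {X j}) (d : ℕ) :
    homogeneousComponent d f ∈ gradedVanishingIdeal P ⊔ Ideal.span {X j} := by
  obtain ⟨g, hg, b, hb, rfl⟩ := Submodule.mem_sup.1 h
  obtain ⟨q, rfl⟩ := Ideal.mem_span_singleton'.1 hb
  rw [map_add, mul_comm]
  refine Submodule.add_mem_sup (homogeneousComponent_mem_gradedVanishingIdeal hg d) ?_
  cases d with
  | zero => rw [homogeneousComponent_zero_X_mul]; exact zero_mem _
  | succ d =>
    rw [homogeneousComponent_succ_X_mul]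
    exact Ideal.mul_mem_right _ _ (Ideal.mem_span_singleton_self _)

theorem IsIndicatorFunction.colon_eq {i : ι} {f : MvPolynomial σ K}
    (hf : IsIndicatorFunction P i f) :
    (gradedVanishingIdeal P).colon {f} = pointIdeal (P i) := by
  obtain ⟨⟨d, hd⟩, hi, hj⟩ := hf
  apply le_antisymm
  · intro q hq
    rw [Submodule.mem_colon_singleton, smul_eq_mul, mul_comm] at hq
    rw [← sum_homogeneousComponent q]
    refine Ideal.sum_mem _ fun k _ => Ideal.subset_span
      ⟨⟨k, homogeneousComponent_isHomogeneous _ _⟩, fun _ => ?_⟩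
    have h1 := homogeneousComponent_mem_gradedVanishingIdeal hq (d + k)
    rw [homogeneousComponent_mul_of_le hd (Nat.le_add_right d k), Nat.add_sub_cancel_left] at h1
    have h2 := eval_eq_zero_of_mem_gradedVanishingIdeal h1 i
    rw [map_mul] at h2
    exact (mul_eq_zero.1 h2).resolve_left hi
  · refine Ideal.span_le.2 ?_
    rintro q ⟨⟨k, hk⟩, hq⟩
    rw [SetLike.mem_coe, Submodule.mem_colon_singleton, smul_eq_mul,
      mem_gradedVanishingIdeal_iff (hk.mul hd)]
    intro l
    rw [map_mul]
    by_cases h : l = i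
    · rw [h, hq (), zero_mul]
    · rw [hj l h, mul_zero]

theorem IsIndicatorFunction.vNumber_le {i : ι} {f : MvPolynomial σ K}
    (hf : IsIndicatorFunction P i f) {d : ℕ} (hd : f.IsHomogeneous d) :
    vNumber (gradedVanishingIdeal P) (pointIdeal (P i)) ≤ d :=
  Nat.sInf_le ⟨f, hd, hf.colon_eq⟩

/-- An indicator function of minimal degree does not lie in `(I, t_j)`. -/
theorem IsIndicatorFunction.notMem_sup {i : ι} {f : MvPolynomial σ K}
    (hf : IsIndicatorFunction P i f)
    (hd : f.IsHomogeneous (vNumber (gradedVanishingIdeal P) (pointIdeal (P i)))) {j : σ}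
    (hj : ∀ i, P i j ≠ 0) : f ∉ gradedVanishingIdeal P ⊔ Ideal.span {X j} := by
  intro h
  obtain ⟨g, hg, q, rfl, -, hq⟩ := exists_eq_add_X_mul hd h
  have hev : ∀ k, eval (P k) (g + X j * q) = P k j * eval (P k) q := fun k => by
    rw [map_add, eval_eq_zero_of_mem_gradedVanishingIdeal hg, zero_add, map_mul, eval_X]
  obtain ⟨-, hi, hk⟩ := hf
  rw [hev] at hi
  rcases hq with rfl | ⟨d', hd', hq⟩
  · simp at hi
  -- Modulo I, f equals t_j q, and t_j vanishes at no point, so q is an indicator function of degree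
  -- one less.
  · have hqi : IsIndicatorFunction P i q := ⟨⟨d', hq⟩, right_ne_zero_of_mul hi, fun k hki => by
      have := hk k hki
      rw [hev] at this
      exact (mul_eq_zero.1 this).resolve_left (hj k)⟩
    have := hqi.vNumber_le hq
    omega

/-- The form P_i(j) t_k f - P_i(k) t_j f vanishes at P_i by cancellation and elsewhere because f
does, so t_k f is a multiple of t_j modulo I. -/
theorem IsIndicatorFunction.X_mul_mem_sup {i : ι} {f : MvPolynomial σ K}
    (hf : IsIndicatorFunction P i f) {j : σ} (hj : P i j ≠ 0) (k : σ) :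
    X k * f ∈ gradedVanishingIdeal P ⊔ Ideal.span {X j} := by
  obtain ⟨⟨d, hd⟩, -, hz⟩ := hf
  have h1 : C (P i j) * X k * f - C (P i k) * X j * f ∈ gradedVanishingIdeal P := by
    rw [mem_gradedVanishingIdeal_iff
      (((isHomogeneous_C_mul_X _ _).mul hd).sub ((isHomogeneous_C_mul_X _ _).mul hd))]
    intro l
    by_cases h : l = i
    · subst h
      simp only [map_sub, map_mul, eval_C, eval_X]
      ring
    · simp [hz l h]
  have h2 : X k * f = C (P i j)⁻¹ * (C (P i j) * X k * f - C (P i k) * X j * f)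
      + C (P i j)⁻¹ * (C (P i k) * f) * X j := by
    have : (C (P i j)⁻¹ * C (P i j) : MvPolynomial σ K) = 1 := by
      rw [← C_mul, inv_mul_cancel₀ hj, C_1]
    linear_combination (-(X k * f)) * this
  rw [h2]
  exact Submodule.add_mem_sup (Ideal.mul_mem_left _ _ h1)
    (Ideal.mul_mem_left _ _ (Ideal.mem_span_singleton_self _))

/-- A form is determined modulo `I` by its values, so it is a combination of the indicator
functions, multiplied by powers of `t_j`. -/
theorem sub_sum_indicator_mem [Fintype ι] {f : ι → MvPolynomial σ K}
    (hf : ∀ i, IsIndicatorFunction P i (f i)) {v : ι → ℕ} (hv : ∀ i, (f i).IsHomogeneous (v i))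
    {j : σ} (hj : ∀ i, P i j ≠ 0) {d : ℕ} (hd : ∀ i, v i ≤ d) {p : MvPolynomial σ K}
    (hp : p.IsHomogeneous d) :
    p - ∑ i, C (eval (P i) p * (eval (P i) (f i))⁻¹ * (P i j ^ (d - v i))⁻¹)
      * X j ^ (d - v i) * f i ∈ gradedVanishingIdeal P := by
  rw [mem_gradedVanishingIdeal_iff (d := d)]
  · intro l
    rw [map_sub, map_sum, Finset.sum_eq_single l]
    · have := (hf l).2.1
      have := pow_ne_zero (d - v l) (hj l)
      simp only [map_mul, eval_C, map_pow, eval_X]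
      field_simp
      ring
    · intro i _ hil
      rw [map_mul, (hf i).2.2 l hil.symm, mul_zero]
    · simp
  · refine hp.sub (IsHomogeneous.sum _ _ _ fun i _ => ?_)
    have := ((isHomogeneous_C_mul_X_pow (eval (P i) p * (eval (P i) (f i))⁻¹
      * (P i j ^ (d - v i))⁻¹) j (d - v i)).mul (hv i))
    rwa [Nat.sub_add_cancel (hd i)] at this

/-- Above the degrees of all indicator functions, each term of the interpolation formula carries a
positive power of t_j. -/
theorem mem_sup_of_lt [Fintype ι] {f : ι → MvPolynomial σ K}
    (hf : ∀ i, IsIndicatorFunction P i (f i)) {v : ι → ℕ} (hv : ∀ i, (f i).IsHomogeneous (v i))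
    {j : σ} (hj : ∀ i, P i j ≠ 0) {d : ℕ} (hd : ∀ i, v i < d) {p : MvPolynomial σ K}
    (hp : p.IsHomogeneous d) : p ∈ gradedVanishingIdeal P ⊔ Ideal.span {X j} := by
  have h := sub_sum_indicator_mem hf hv hj (fun i => (hd i).le) hp
  rw [← sub_add_cancel p (∑ i, _ * f i)]
  refine Submodule.add_mem_sup h (Ideal.sum_mem _ fun i _ => Ideal.mul_mem_right _ _
    (Ideal.mul_mem_left _ _ (Ideal.pow_mem_of_mem _ (Ideal.mem_span_singleton_self _) _ ?_)))
  have := hd i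
  omega

end VanishingIdeal

/-! ### Standard monomials and GRevLex -/

section StandardMonomials

theorem mem_footprint_of_mem_support {σ K : Type*} [Field K] {ord : MonomialOrder σ}
    {I : Ideal (MvPolynomial σ K)} {f : MvPolynomial σ K} (hf : f ∈ footprintSpan ord I)
    {a : σ →₀ ℕ} (ha : a ∈ f.support) : a ∈ footprint ord I := by
  by_contra hn
  have : footprintSpan ord I ≤ LinearMap.ker (lcoeff K a) := by
    refine Submodule.span_le.2 ?_
    rintro _ ⟨b, hb, rfl⟩
    have hne : b ≠ a := by
      rintro rfl
      exact hn hb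
    classical exact (coeff_monomial _ _ _).trans (if_neg hne)
  exact mem_support_iff.1 ha (this hf)

theorem degree_eq_of_mem_support {σ K : Type*} [Field K] {p : MvPolynomial σ K} {d : ℕ}
    (hp : p.IsHomogeneous d) {b : σ →₀ ℕ} (hb : b ∈ p.support) : b.degree = d := by
  have := hp (mem_support_iff.1 hb)
  rwa [Finsupp.degree_eq_weight_one]

theorem degree_notMem_footprint {σ K : Type*} [Field K] {ord : MonomialOrder σ}
    {I : Ideal (MvPolynomial σ K)} {f : MvPolynomial σ K} (hf : f ∈ I) (h0 : f ≠ 0) :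
    ord.degree f ∉ footprint ord I :=
  fun h => h (Ideal.subset_span ⟨f, hf, h0, rfl⟩)

variable {K ι : Type*} [Field K] {n : ℕ} {P : ι → Fin (n + 1) → K}

theorem grevLex_lt_of_last {a b : Fin (n + 1) →₀ ℕ} (hdeg : a.degree = b.degree)
    (ha : a (Fin.last n) ≠ 0) (hb : b (Fin.last n) = 0) :
    (MonomialOrder.grevLex n).toSyn a < (MonomialOrder.grevLex n).toSyn b :=
  MonomialOrder.grevLex_lt_iff.2 (Or.inr ⟨hdeg, Fin.last n,
    fun j hj => absurd hj (Fin.le_last j).not_gt, by omega⟩)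

/-- Standard monomials of the same degree that are not divisible by the last variable are linearly
independent modulo `(I, t_s)`. -/
theorem eq_zero_of_mem_sup {p : MvPolynomial (Fin (n + 1)) K} {d : ℕ} (hp : p.IsHomogeneous d)
    (hsupp : ∀ a ∈ p.support, a ∈ footprint (MonomialOrder.grevLex n) (gradedVanishingIdeal P) ∧
      a (Fin.last n) = 0)
    (h : p ∈ gradedVanishingIdeal P ⊔ Ideal.span {X (Fin.last n)}) : p = 0 := by
  by_contra h0
  obtain ⟨g, hg, q, hpq, hgd, -⟩ := exists_eq_add_X_mul hp h
  have hcoeff : ∀ a : Fin (n + 1) →₀ ℕ, a (Fin.last n) = 0 → coeff a g = coeff a p := by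
    intro a ha
    rw [hpq, coeff_add, coeff_X_mul', if_neg (by simpa using ha), add_zero]
  obtain ⟨c, hc⟩ := support_nonempty.2 h0
  have hcg : c ∈ g.support := by
    rw [mem_support_iff, hcoeff c (hsupp c hc).2]
    exact mem_support_iff.1 hc
  have hg0 : g ≠ 0 := support_nonempty.1 ⟨c, hcg⟩
  have hdeg := MonomialOrder.degree_mem_support (m := MonomialOrder.grevLex n) hg0
  -- If t_s does not divide the leading monomial of g ∈ I, that monomial occurs in p and would be
  -- standard. If t_s divides it, GRevLex puts it below the monomial c of g, which is free of t_s.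
  by_cases hb : (MonomialOrder.grevLex n).degree g (Fin.last n) = 0
  · refine degree_notMem_footprint hg hg0 (hsupp _ ?_).1
    rw [mem_support_iff, ← hcoeff _ hb]
    exact mem_support_iff.1 hdeg
  · refine (grevLex_lt_of_last ?_ hb (hsupp c hc).2).not_ge (MonomialOrder.le_degree hcg)
    rw [degree_eq_of_mem_support hgd hdeg, degree_eq_of_mem_support hgd hcg]

end StandardMonomials

/-! ### The unique standard monomial of top degree free of t_s -/

section Socle

variable {K ι : Type*} [Field K] {n : ℕ} {P : ι → Fin (n + 1) → K}

theorem mem_span_X_iff {σ : Type*} {p : MvPolynomial σ K} {j : σ} :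
    p ∈ Ideal.span {X j} ↔ ∀ a ∈ p.support, a j ≠ 0 := by
  have := mem_ideal_span_X_image (x := p) (s := {j})
  simpa using this

/-- Both monomials are in the top degree e, so their products with any variable die in A. The socle
relation makes them dependent modulo (I, t_s), which is impossible for distinct standard monomials
free of t_s. -/
theorem eq_of_socle_relation {e : ℕ}
    (hsoc : ∀ p q : MvPolynomial (Fin (n + 1)) K,
      (∀ i, X i * p ∈ gradedVanishingIdeal P ⊔ Ideal.span {X (Fin.last n)}) →
      (∀ i, X i * q ∈ gradedVanishingIdeal P ⊔ Ideal.span {X (Fin.last n)}) →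
      ∃ α β : K, (α ≠ 0 ∨ β ≠ 0) ∧
        C α * p + C β * q ∈ gradedVanishingIdeal P ⊔ Ideal.span {X (Fin.last n)})
    (he : ∀ d, e < d → ∀ p : MvPolynomial (Fin (n + 1)) K, p.IsHomogeneous d →
      p ∈ gradedVanishingIdeal P ⊔ Ideal.span {X (Fin.last n)})
    {a b : Fin (n + 1) →₀ ℕ}
    (ha : a ∈ footprintDegree (MonomialOrder.grevLex n) (gradedVanishingIdeal P) e)
    (hb : b ∈ footprintDegree (MonomialOrder.grevLex n) (gradedVanishingIdeal P) e)
    (ha' : a (Fin.last n) = 0) (hb' : b (Fin.last n) = 0) : a = b := by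
  classical
  by_contra hab
  have hhom : ∀ c : Fin (n + 1) →₀ ℕ, c.degree = e → ∀ r : K, (monomial c r).IsHomogeneous e :=
    fun c hc r => isHomogeneous_monomial r hc
  have hs : ∀ c : Fin (n + 1) →₀ ℕ, c.degree = e → ∀ i, X i * monomial c (1 : K) ∈
      gradedVanishingIdeal P ⊔ Ideal.span {X (Fin.last n)} := fun c hc i =>
    he (1 + e) (by omega) _ ((isHomogeneous_X K i).mul (hhom c hc 1))
  obtain ⟨α, β, h0, h⟩ := hsoc _ _ (hs a ha.2) (hs b hb.2)
  rw [C_mul_monomial, C_mul_monomial, mul_one, mul_one] at h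
  have hz := eq_zero_of_mem_sup ((hhom a ha.2 α).add (hhom b hb.2 β)) (fun c hc => ?_) h
  · have h1 := congrArg (coeff a) hz
    have h2 := congrArg (coeff b) hz
    simp only [coeff_add, coeff_monomial, if_true, hab, Ne.symm hab, if_false, add_zero, zero_add,
      coeff_zero] at h1 h2
    exact h0.elim (fun h => h h1) (fun h => h h2)
  · rcases Finset.mem_union.1 (support_add hc) with h' | h' <;>
      rw [Finset.mem_singleton.1 (support_monomial_subset h')]
    · exact ⟨ha.1, ha'⟩
    · exact ⟨hb.1, hb'⟩

/-- Forms outside of a homogeneous ideal `J` that are linearly dependent modulo `J` have the same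
degree. -/
theorem degree_eq_of_relation {J : Ideal (MvPolynomial (Fin (n + 1)) K)}
    (hJ : ∀ p ∈ J, ∀ d, homogeneousComponent d p ∈ J) {p q : MvPolynomial (Fin (n + 1)) K}
    {d e : ℕ} (hp : p.IsHomogeneous d) (hq : q.IsHomogeneous e) (hp' : p ∉ J) (hq' : q ∉ J)
    (h : ∃ α β : K, (α ≠ 0 ∨ β ≠ 0) ∧ C α * p + C β * q ∈ J) : d = e := by
  by_contra hde
  obtain ⟨α, β, h0, h⟩ := h
  have hunit : ∀ (c : K) (r : MvPolynomial (Fin (n + 1)) K), c ≠ 0 → C c * r ∈ J → r ∈ J := by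
    intro c r hc hr
    have := J.mul_mem_left (C c⁻¹) hr
    rwa [← mul_assoc, ← C_mul, inv_mul_cancel₀ hc, C_1, one_mul] at this
  have h1 := hJ _ h d
  have h2 := hJ _ h e
  rw [map_add, homogeneousComponent_C_mul, homogeneousComponent_C_mul,
    homogeneousComponent_of_mem hp, homogeneousComponent_of_mem hq] at h1 h2
  rw [if_pos rfl, if_neg hde, mul_zero, add_zero] at h1
  rw [if_pos rfl, if_neg (Ne.symm hde), mul_zero, zero_add] at h2
  exact h0.elim (fun h => hp' (hunit α p h h1)) (fun h => hq' (hunit β q h h2))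

theorem leadingCoeff_grevLex_eq {a : Fin (n + 1) →₀ ℕ} {p : MvPolynomial (Fin (n + 1)) K}
    (hp : p.IsHomogeneous a.degree) (ha : coeff a p ≠ 0) (ha' : a (Fin.last n) = 0)
    (h : ∀ b ∈ p.support, b (Fin.last n) = 0 → b = a) :
    (MonomialOrder.grevLex n).leadingCoeff p = coeff a p := by
  have hp0 : p ≠ 0 := by
    rintro rfl
    exact ha (coeff_zero a)
  have hdeg := MonomialOrder.degree_mem_support (m := MonomialOrder.grevLex n) hp0
  suffices (MonomialOrder.grevLex n).degree p = a by rw [MonomialOrder.leadingCoeff, this]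
  by_contra hne
  exact (grevLex_lt_of_last (degree_eq_of_mem_support hp hdeg)
    (fun h' => hne (h _ hdeg h')) ha').not_ge (MonomialOrder.le_degree (mem_support_iff.2 ha))

theorem exists_eq_smul_monomial_add_X_mul {a : Fin (n + 1) →₀ ℕ}
    {p : MvPolynomial (Fin (n + 1)) K} {d : ℕ} (hp : p.IsHomogeneous (d + 1))
    (ha : a.degree = d + 1)
    (h : ∀ b ∈ p.support, b (Fin.last n) = 0 → b = a) :
    ∃ q : MvPolynomial (Fin (n + 1)) K, q.IsHomogeneous d ∧
      p = coeff a p • monomial a 1 + X (Fin.last n) * q := by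
  classical
  have hmem : p - monomial a (coeff a p) ∈ Ideal.span {X (Fin.last n)} := by
    rw [mem_span_X_iff]
    intro b hb hb'
    rw [mem_support_iff, coeff_sub, coeff_monomial] at hb
    split_ifs at hb with hab
    · rw [hab, sub_self] at hb
      exact hb rfl
    · rw [sub_zero, ← mem_support_iff] at hb
      exact hab (h b hb hb').symm
  obtain ⟨q, hq⟩ := Ideal.mem_span_singleton'.1 hmem
  refine ⟨homogeneousComponent d q, homogeneousComponent_isHomogeneous _ _, ?_⟩
  rw [← homogeneousComponent_succ_X_mul, mul_comm, hq,
    homogeneousComponent_eq_self (hp.sub (isHomogeneous_monomial _ ha)), smul_monomial, smul_eq_mul,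
    mul_one, add_sub_cancel]

end Socle

/-! ### The parity check matrix -/

section ParityCheck

variable {K ι : Type*} [Field K] [Fintype ι] [Nonempty ι] {n : ℕ} {P : ι → Fin (n + 1) → K}

theorem isParityCheckMatrix_of_eq_smul_monomial_add {d : ℕ}
    {f G : ι → MvPolynomial (Fin (n + 1)) K} (hf : ∀ i, IsIndicatorFunction P i (f i))
    (hhom : ∀ i, (f i).IsHomogeneous (d + 1)) {a : Fin (n + 1) →₀ ℕ}
    (ha : a ∈ footprintDegree (MonomialOrder.grevLex n) (gradedVanishingIdeal P) (d + 1))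
    (ha' : a (Fin.last n) = 0) {c : ι → K} (hc : ∀ i, c i ≠ 0) (hG : ∀ i, (G i).IsHomogeneous d)
    (hfG : ∀ i, f i = c i • monomial a 1 + X (Fin.last n) * G i)
    (hP : ∀ i, P i (Fin.last n) = 1) :
    IsParityCheckMatrix (Matrix.of fun (_ : Fin 1) i => c i * (eval (P i) (f i))⁻¹)
      (reedMullerCode P d) := by
  have hsum : ∀ y : ι → K, ∑ i, C (y i) * f i
      = monomial a (∑ i, y i * c i) + X (Fin.last n) * ∑ i, C (y i) * G i := by
    intro y
    rw [Finset.mul_sum, map_sum, ← Finset.sum_add_distrib]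
    refine Finset.sum_congr rfl fun i _ => ?_
    conv_lhs => rw [hfG i]
    rw [smul_monomial, smul_eq_mul, mul_one, mul_add, C_mul_monomial]
    ring
  have hmulVec : ∀ x : ι → K, (Matrix.of fun (_ : Fin 1) i => c i * (eval (P i) (f i))⁻¹).mulVec x
      = 0 ↔ ∑ i, x i * (eval (P i) (f i))⁻¹ * c i = 0 := by
    intro x
    have : ∀ k, (Matrix.of fun (_ : Fin 1) i => c i * (eval (P i) (f i))⁻¹).mulVec x k
        = ∑ i, x i * (eval (P i) (f i))⁻¹ * c i :=
      fun k => Finset.sum_congr rfl fun i _ => by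
        change c i * (eval (P i) (f i))⁻¹ * x i = _
        ring
    rw [_root_.funext_iff]
    simp only [this, Pi.zero_apply, forall_const]
  refine ⟨?_, fun x => ?_⟩
  · rw [linearIndependent_unique_iff]
    intro h
    obtain ⟨i⟩ := ‹Nonempty ι›
    exact mul_ne_zero (hc i) (inv_ne_zero (hf i).2.1) (congrFun h i)
  rw [hmulVec]
  constructor
  · rintro ⟨p, hp, rfl⟩
    -- Multiplying by t_s keeps the values and raises the degree to that of the f_i, where p can be
    -- interpolated without extra powers of t_s.
    have hXp : (X (Fin.last n) * p).IsHomogeneous (d + 1) := by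
      have := (isHomogeneous_X K (Fin.last n)).mul hp
      rwa [add_comm 1 d] at this
    have h := sub_sum_indicator_mem hf hhom (j := Fin.last n) (fun i => by simp [hP i])
      (fun i => le_rfl) hXp
    simp only [Nat.sub_self, pow_zero, inv_one, mul_one, map_mul (eval _), eval_X, hP,
      one_mul] at h
    rw [hsum fun i => eval (P i) p * (eval (P i) (f i))⁻¹] at h
    have hm : monomial a (∑ i, eval (P i) p * (eval (P i) (f i))⁻¹ * c i) ∈
        gradedVanishingIdeal P ⊔ Ideal.span {X (Fin.last n)} := by
      rw [← neg_mem_iff]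
      refine Submodule.mem_sup.2 ⟨_, h,
        (∑ i, C (eval (P i) p * (eval (P i) (f i))⁻¹) * G i - p) * X (Fin.last n),
        Ideal.mul_mem_left _ _ (Ideal.mem_span_singleton_self _), ?_⟩
      ring
    -- The multiple of t^a lies in (I, t_s), and t^a is standard and free of t_s, so the coefficient
    -- is zero.
    have hz := eq_zero_of_mem_sup (isHomogeneous_monomial _ ha.2) (fun b hb => ?_) hm
    · exact monomial_eq_zero.1 hz
    · rw [Finset.mem_singleton.1 (support_monomial_subset hb)]
      exact ⟨ha.1, ha'⟩
  · intro h
    -- The interpolant of x by the f_i has no t^a term, so it is t_s times this form, which has the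
    -- same values because t_s = 1 at every point.
    refine ⟨∑ i, C (x i * (eval (P i) (f i))⁻¹) * G i, ?_, ?_⟩
    · refine IsHomogeneous.sum _ _ _ fun i _ => ?_
      simpa using (isHomogeneous_C (Fin (n + 1)) (x i * (eval (P i) (f i))⁻¹)).mul (hG i)
    · have hs := hsum fun i => x i * (eval (P i) (f i))⁻¹
      rw [h, map_zero, zero_add] at hs
      ext1 k
      have hk := congrArg (eval (P k)) hs
      rw [map_mul, eval_X, hP, one_mul, map_sum, Finset.sum_eq_single k] at hk
      · rw [map_mul, eval_C, mul_assoc, inv_mul_cancel₀ (hf k).2.1, mul_one] at hk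
        rw [hk]
        rfl
      · intro i _ hik
        rw [map_mul, (hf i).2.2 k hik.symm, mul_zero]
      · simp

end ParityCheck

/-! ### The main theorem -/

theorem mainTheorem10 {K : Type*} [Field K] [Finite K] {n m : ℕ} (hm : 2 ≤ m)
    (P : Fin m → Fin (n + 1) → K) (hP : ∀ i, P i ≠ 0)
    (hdistinct : Function.Injective fun i => Projectivization.mk K (P i) (hP i))
    (I : Ideal (MvPolynomial (Fin (n + 1)) K)) (hI : I = gradedVanishingIdeal P)
    (r₀ : ℕ) (hr₀ : r₀ = quotientRegularity I)
    (f : Fin m → MvPolynomial (Fin (n + 1)) K)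
    (hf : ∀ i, IsStandardIndicatorFunction (MonomialOrder.grevLex n) P i (f i))
    (hreg : IsSMulRegular (MvPolynomial (Fin (n + 1)) K ⧸ I)
      (X (Fin.last n) : MvPolynomial (Fin (n + 1)) K))
    (hG : IsGorensteinIdeal I) :
    (∃ a ∈ footprintDegree (MonomialOrder.grevLex n) I r₀,
      a (Fin.last n) = 0 ∧
      IsEssentialMonomial (MonomialOrder.grevLex n) P a ∧
      ∃ (c : Fin m → K) (G : Fin m → MvPolynomial (Fin (n + 1)) K), ∀ i,
        c i ≠ 0 ∧ (G i).IsHomogeneous (r₀ - 1) ∧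
        f i = c i • monomial a 1 + X (Fin.last n) * G i ∧
        c i = (MonomialOrder.grevLex n).leadingCoeff (f i)) ∧
    ((∀ i, P i (Fin.last n) = 1) →
      IsParityCheckMatrix
        (Matrix.of fun (_ : Fin 1) i =>
          (MonomialOrder.grevLex n).leadingCoeff (f i) * (eval (P i) (f i))⁻¹)
        (reedMullerCode P (r₀ - 1))) := by
  subst hI
  have hreg' : ∀ p, X (Fin.last n) * p ∈ gradedVanishingIdeal P → p ∈ gradedVanishingIdeal P :=
    (isSMulRegular_quotient_iff_mem_of_smul_mem _ _).1 hreg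
  -- If t_s vanished at P_i, then t_s f_i would lie in I while f_i does not, contradicting
  -- regularity.
  have hlast : ∀ i, P i (Fin.last n) ≠ 0 := by
    intro i h0
    obtain ⟨d, hd⟩ := (hf i).1.1
    refine (hf i).1.2.1 (eval_eq_zero_of_mem_gradedVanishingIdeal (hreg' (f i) ?_) i)
    rw [mem_gradedVanishingIdeal_iff ((isHomogeneous_X K _).mul hd)]
    intro j
    rw [map_mul, eval_X]
    by_cases hj : j = i
    · rw [hj, h0, zero_mul]
    · rw [(hf i).1.2.2 j hj, mul_zero]
  have hsocle : ∀ i k, X k * f i ∈ gradedVanishingIdeal P ⊔ Ideal.span {X (Fin.last n)} :=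
    fun i k => (hf i).1.X_mul_mem_sup (hlast i) k
  have hnot : ∀ i, f i ∉ gradedVanishingIdeal P ⊔ Ideal.span {X (Fin.last n)} :=
    fun i => (hf i).1.notMem_sup (hf i).2.2 hlast
  have hrel : ∀ p q : MvPolynomial (Fin (n + 1)) K, _ → _ → _ :=
    fun p q hp hq => hG.exists_socle_relation hreg' (p := p) (q := q) hp hq
  -- Any two f_i are dependent in the socle of A and non-zero there, so they share one degree.
  obtain ⟨e, hv⟩ : ∃ e, ∀ i, vNumber (gradedVanishingIdeal P) (pointIdeal (P i)) = e :=
    ⟨vNumber (gradedVanishingIdeal P) (pointIdeal (P ⟨0, by omega⟩)), fun i =>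
      degree_eq_of_relation (fun p hp d => homogeneousComponent_mem_sup hp d) (hf i).2.2
        (hf _).2.2 (hnot i) (hnot _) (hrel _ _ (hsocle i) (hsocle _))⟩
  have hhom : ∀ i, (f i).IsHomogeneous e := fun i => hv i ▸ (hf i).2.2
  have he : ∀ d, e < d → ∀ p : MvPolynomial (Fin (n + 1)) K, p.IsHomogeneous d →
      p ∈ gradedVanishingIdeal P ⊔ Ideal.span {X (Fin.last n)} := fun d hd p hp =>
    mem_sup_of_lt (fun i => (hf i).1) hhom hlast (fun _ => hd) hp
  have hr : r₀ = e := by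
    obtain ⟨F, -⟩ := hG
    rw [hr₀]
    exact quotientRegularity_eq F hreg' he (hhom ⟨0, by omega⟩) (hnot _)
  clear hr₀
  subst hr
  -- With at least two points an indicator function is not constant, so subtracting 1 from r_0 is
  -- not truncated.
  obtain ⟨d, rfl⟩ : ∃ d, r₀ = d + 1 := by
    refine Nat.exists_eq_succ_of_ne_zero ?_
    rintro rfl
    have hC := homogeneousComponent_eq_self (hhom ⟨0, by omega⟩)
    rw [homogeneousComponent_zero] at hC
    have h1 := (hf ⟨0, by omega⟩).1.2.1
    have h2 := (hf ⟨0, by omega⟩).1.2.2 ⟨1, by omega⟩ (by simp)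
    rw [← hC, eval_C] at h1 h2
    exact h1 h2
  have hfoot : ∀ i, ∀ b ∈ (f i).support,
      b ∈ footprintDegree (MonomialOrder.grevLex n) (gradedVanishingIdeal P) (d + 1) :=
    fun i b hb => ⟨mem_footprint_of_mem_support (hf i).2.1 hb,
      degree_eq_of_mem_support (hhom i) hb⟩
  have hex : ∀ g : MvPolynomial (Fin (n + 1)) K,
      g ∉ gradedVanishingIdeal P ⊔ Ideal.span {X (Fin.last n)} →
      ∃ b ∈ g.support, b (Fin.last n) = 0 := by
    intro g hg
    by_contra! hc
    exact hg (Ideal.mem_sup_right (mem_span_X_iff.2 hc))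
  obtain ⟨a, ha, ha'⟩ := hex _ (hnot ⟨0, by omega⟩)
  have haf := hfoot _ a ha
  have huniq : ∀ i, ∀ b ∈ (f i).support, b (Fin.last n) = 0 → b = a := fun i b hb hb' =>
    eq_of_socle_relation hrel he (hfoot i b hb) haf hb' ha'
  have hcoeff : ∀ i, coeff a (f i) ≠ 0 := by
    intro i
    obtain ⟨b, hb, hb'⟩ := hex _ (hnot i)
    rw [← huniq i b hb hb']
    exact mem_support_iff.1 hb
  have hlc : ∀ i, (MonomialOrder.grevLex n).leadingCoeff (f i) = coeff a (f i) := fun i =>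
    leadingCoeff_grevLex_eq (haf.2 ▸ hhom i) (hcoeff i) ha' (huniq i)
  choose G hG hfG using fun i => exists_eq_smul_monomial_add_X_mul (hhom i) haf.2 (huniq i)
  refine ⟨⟨a, haf, ha', ⟨haf.1, fun i g hg => ?_⟩, fun i => coeff a (f i), G, fun i =>
    ⟨hcoeff i, hG i, hfG i, (hlc i).symm⟩⟩, fun hP1 => ?_⟩
  -- Essentiality concerns every standard indicator function g, not only the chosen f_i, so the
  -- support argument is repeated for g.
  · have hgn := hg.1.notMem_sup hg.2.2 hlast
    obtain ⟨b, hb, hb'⟩ := hex g hgn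
    have hbf : b ∈ footprintDegree (MonomialOrder.grevLex n) (gradedVanishingIdeal P) (d + 1) :=
      ⟨mem_footprint_of_mem_support hg.2.1 hb,
        (degree_eq_of_mem_support hg.2.2 hb).trans (hv i)⟩
    rw [← eq_of_socle_relation hrel he hbf haf hb' ha']
    exact mem_support_iff.1 hb
  · have : Nonempty (Fin m) := ⟨⟨0, by omega⟩⟩
    simp only [hlc, Nat.add_sub_cancel]
    exact isParityCheckMatrix_of_eq_smul_monomial_add (fun i => (hf i).1) hhom haf ha' hcoeff hG hfG
      hP1
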